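/- Fix an integer $r\ge 1$. For every $n=1,2,\ldots$ let $(X_{n,t})_{t=1}^{\infty}$ be a strictly stationary sequence of real random variables on a probability space (which may depend on $n$) that is absolutely regular, i.e. $\beta_n(t)\to 0$ as $t\to\infty$, where $$\beta_n(t)=\sup_{k\ge 1}\mathbf{E}\Bigl\{\sup_{A\in\mathcal{F}_{n,k+t}^{\infty}}\bigl|\mathbf{P}\{A\mid\mathcal{F}_{n,1}^{k}\}-\mathbf{P}\{A\}\bigr|\Bigr\},$$ $\mathcal{F}_{n,a}^{b}$ is the $\sigma$-algebra generated by the $X_{n,t}$, $a\le t\le b$, and regular versions of the conditional probabilities are used. For $n\ge 1$ and $1\le j_1,\ldots,j_r\le n$ (repetitions allowed) let $f_{n;j_1,\ldots,j_r}:\mathbb{R}^r\to\mathbb{R}$ be measurable functions with $|f_{n;j_1,\ldots,j_r}|\le F_n<\infty$, and let $$V_n=\sum_{j_1,\ldots,j_r=1}^{n}f_{n;j_1,\ldots,j_r}(X_{n,j_1},\ldots,X_{n,j_r}),\qquad V_n^{*}=\frac{V_n-\mathbf{E}V_n}{\sqrt{\mathbf{D}V_n}},$$ where $\mathbf{D}$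 denotes the variance and $\mathbf{D}V_n>0$ for all sufficiently large $n$. Let $(m_n)$ be a sequence of positive integers, and suppose that there is $b_0\in(0,2/3]$ such that for all $b\in(0,b_0]$ $$\frac{F_n^2\,m_n^{2-b}\,n^{2(r-1)+b}\,r^{4-2b}}{\mathbf{D}V_n}+\bigl(\beta_n(m_n)\bigr)^{b}\,\frac{F_n^2\,n^{2r}}{\mathbf{D}V_n}\longrightarrow 0,\qquad n\to\infty.$$ Then, as $n\to\infty$, all moments $\mathbf{E}(V_n^{*})^k$, $k=1,2,\ldots$, converge to the corresponding moments of the standard normal law, and the distribution function of $V_n^{*}$ converges at every point to the distribution function of the standard normal law. -/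

import Mathlib

open MeasureTheory ProbabilityTheory Filter Topology

noncomputable section

/-- Strict stationarity of a sequence of real random variables: the finite-dimensional
distributions are invariant under time shifts. The index `t : ℕ` stands for the time `t + 1`
of a sequence that starts at time `1`. -/
def StrictlyStationary {Ω : Type*} [MeasurableSpace Ω] (μ : Measure Ω) (X : ℕ → Ω → ℝ) : Prop :=
  ∀ (k : ℕ) (t : Fin k → ℕ) (τ : ℕ),
    μ.map (fun ω i => X (t i + τ) ω) = μ.map (fun ω i => X (t i) ω)

/-- The past up to index `k`, i.e. `(X_0, …, X_k)`; it generates `F_{≤ k}`. -/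
def past {Ω : Type*} (X : ℕ → Ω → ℝ) (k : ℕ) (ω : Ω) : Fin (k + 1) → ℝ :=
  fun i => X i ω

/-- The future from index `l` on, i.e. `(X_l, X_{l+1}, …)`; it generates `F_{≥ l}`: the events
of `F_{≥ l}` are exactly the preimages of the measurable subsets of `ℕ → ℝ`. -/
def future {Ω : Type*} (X : ℕ → Ω → ℝ) (l : ℕ) (ω : Ω) : ℕ → ℝ :=
  fun s => X (l + s) ω

/-- The absolute regularity coefficient
`β(m) = sup_k E { sup_{A ∈ F_{≥ k+m}} |P(A | F_{≤ k}) - P(A)| }`.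
The conditional probabilities are taken in their regular version (the conditional distribution
of the future given the past), so that the inner supremum over uncountably many events is
meaningful. For a sequence indexed by the positive times only, the supremum over `k` replaces
the infinite past; by stationarity the expectations are nondecreasing in `k`. -/
def absRegCoeff {Ω : Type*} [MeasurableSpace Ω] (μ : Measure Ω) [IsProbabilityMeasure μ]
    (X : ℕ → Ω → ℝ) (m : ℕ) : ℝ :=
  (⨆ k : ℕ, ∫⁻ ω, ⨆ (A : Set (ℕ → ℝ)) (_ : MeasurableSet A),
    ENNReal.ofReal
      |(condDistrib (future X (k + m)) (past X k) μ (past X k ω)).real A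
        - μ.real (future X (k + m) ⁻¹' A)| ∂μ).toReal

/-- The absolute regularity condition: `β(m) → 0` as `m → ∞`
(the coefficients are automatically nonincreasing in `m`). -/
def AbsolutelyRegular {Ω : Type*} [MeasurableSpace Ω] (μ : Measure Ω) [IsProbabilityMeasure μ]
    (X : ℕ → Ω → ℝ) : Prop :=
  Tendsto (absRegCoeff μ X) atTop (𝓝 0)

/-- The nonhomogeneous `V`-statistic of order `r` of `X_0, …, X_{n-1}`: the sum over all
`r`-tuples of indices, repeated ones included, of `f_j (X_{j_1}, …, X_{j_r})`. -/
def vStat {Ω : Type*} {n r : ℕ} (f : (Fin r → Fin n) → (Fin r → ℝ) → ℝ) (X : ℕ → Ω → ℝ)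
    (ω : Ω) : ℝ :=
  ∑ j : Fin r → Fin n, f j (fun i => X (j i) ω)

/-- The centred and normalised random variable `Y* = (Y - E Y) / √(D Y)`. -/
def standardized {Ω : Type*} [MeasurableSpace Ω] (μ : Measure Ω) (Y : Ω → ℝ) (ω : Ω) : ℝ :=
  (Y ω - ∫ ω', Y ω' ∂μ) / Real.sqrt (variance Y μ)

end

/-!
Asymptotic normality of nonhomogeneous `V`-statistics of an absolutely regular sequence, by the
method of cumulants.

The statistic is a sum of the random variables `f j (X_{j 0}, …, X_{j (r - 1)})` over `n ^ r` index
tuples `j`. Call two index tuples close when an entry of one is at distance less than `m` from an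
entry of the other; each tuple has at most `D = 2 m r² n ^ (r - 1)` close ones
(`card_isClose_le`). The `k`-th cumulant of the sum is the sum of the joint cumulants over all
`k`-tuples of summands (`cumulantSeq_sum`). For the `k`-tuples whose closeness graph is connected,
at most `c n ^ r D ^ (k - 1)` in number (`card_connected_le`), the joint cumulant is bounded
trivially (`abs_jointCumulant_le`). If the graph is not connected, the times involved fall into two
groups at distance at least `m`. Decoupling the last block of times with the help of the
absolute regularity coefficient `β`, and going on by induction, one sees that functions of the two
groups are uncorrelated up to a multiple of `β` even when the groups interlace
(`abs_covariance_le_absRegCoeff`). Hence the joint moments nearly factor along the splitting, and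
the joint cumulant is of order `β` (`abs_jointCumulant_le_of_factorization`). The resulting bound on
the `k`-th cumulant of the standardized statistic is, up to a constant, the `k / 2`-th power of the
expression in the asymptotic condition with `b = 2 / k`; so all cumulants of order `k ≥ 2 / b₀`
tend to zero (`tendsto_cumulantSeq_standardized`).

The condition says nothing about the cumulants of order between `3` and `2 / b₀`. They are dealt
with by a theorem of Janson (`tendsto_moment_of_tendsto_cumulantSeq`), a consequence of a theorem of
Marcinkiewicz: a law with finitely many nonzero cumulants is normal. For a sequence of moments with
cumulant generating polynomial `K`, positivity gives `|exp (K z)| ≤ exp (K (re z))` for all complex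
`z` (`re_cumulantPoly_le`), and comparing leading terms along rays excludes a degree above two
(`leading_cumulant_eq_zero`). The argument works with limits of moment sequences only, without
limit laws. Convergence of the distribution functions then follows from that of the moments, by
Taylor expansion of the characteristic functions and Lévy's continuity theorem.

Cumulants are defined by their recursion in terms of moments (`jointCumulant`, `cumulantSeq`), which
avoids sums over set partitions.
-/

/-! ### Joint cumulants of a set function -/

section JointCumulant

variable {ι : Type*} [LinearOrder ι]

/-- The joint cumulants of a family of joint moments. The number `m B` stands for the moment
`E ∏_{i ∈ B} Y i`; the cumulants are determined by
`m B = ∑_C jointCumulant m C * m (B \ C)`, where `C` runs over the subsets of `B` that contain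
the least element of `B`. For `C ⊆ B` with `B` nonempty, the condition `C.min = B.min`
(in `WithTop ι`) says exactly that `C` contains the least element of `B`. -/
noncomputable def jointCumulant (m : Finset ι → ℝ) (B : Finset ι) : ℝ :=
  m B - ∑ C ∈ (B.ssubsets.filter (fun C => C.min = B.min)).attach,
    jointCumulant m C.1 * m (B \ C.1)
termination_by B.card
decreasing_by exact Finset.card_lt_card (Finset.mem_ssubsets.1 (Finset.mem_filter.1 C.2).1)

lemma jointCumulant_eq (m : Finset ι → ℝ) (B : Finset ι) :
    jointCumulant m B = m B - ∑ C ∈ B.ssubsets with C.min = B.min,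
      jointCumulant m C * m (B \ C) := by
  rw [jointCumulant, Finset.sum_attach (B.ssubsets.filter (fun C => C.min = B.min))
    (fun C => jointCumulant m C * m (B \ C))]

lemma moment_eq_sum_jointCumulant (m : Finset ι → ℝ) (hm : m ∅ = 1) (B : Finset ι) :
    m B = ∑ C ∈ B.powerset with C.min = B.min, jointCumulant m C * m (B \ C) := by
  have h : B.powerset = insert B B.ssubsets := by
    rw [Finset.ssubsets, Finset.insert_erase (Finset.mem_powerset_self B)]
  rw [h, Finset.filter_insert, if_pos rfl, Finset.sum_insert (by simp), jointCumulant_eq m B]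
  simp [hm]

lemma card_filter_ssubsets_le (B : Finset ι) (p : Finset ι → Prop) [DecidablePred p] :
    ((B.ssubsets.filter p).card : ℝ) ≤ 2 ^ B.card := by
  have h : (B.ssubsets.filter p).card ≤ 2 ^ B.card := by
    rw [← Finset.card_powerset]
    exact Finset.card_le_card ((Finset.filter_subset _ _).trans (Finset.erase_subset _ _))
  exact_mod_cast h

lemma one_add_two_pow_mul_four_pow_le (s : ℕ) :
    (1 : ℝ) + 2 ^ (s + 1) * 4 ^ (s * s) ≤ 4 ^ ((s + 1) * (s + 1)) := by
  have e : (4 : ℝ) ^ ((s + 1) * (s + 1)) = 4 ^ (s * s) * (4 ^ s * 4 ^ s * 4) := by ring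
  have e2 : (4 : ℝ) ^ s = 2 ^ s * 2 ^ s := by rw [← mul_pow]; norm_num
  have h1 : (1 : ℝ) ≤ 2 ^ s := one_le_pow₀ (by norm_num)
  have h2 : (1 : ℝ) ≤ 4 ^ (s * s) := one_le_pow₀ (by norm_num)
  have h3 : (1 : ℝ) ≤ 4 ^ s := one_le_pow₀ (by norm_num)
  have h5 : 1 + 2 * (2 : ℝ) ^ s ≤ 4 ^ s * 4 ^ s * 4 := by nlinarith
  rw [e, pow_succ]
  nlinarith

/-- The joint cumulants of a family of moments bounded by one are bounded in terms of the
order only. -/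
lemma abs_jointCumulant_le (m : Finset ι → ℝ) (hm : ∀ B, |m B| ≤ 1) (B : Finset ι) :
    |jointCumulant m B| ≤ 4 ^ (B.card * B.card) := by
  induction B using Finset.strongInduction with
  | _ B ih =>
  rw [jointCumulant_eq]
  rcases Nat.eq_zero_or_pos B.card with h0 | h0
  · have : B = ∅ := Finset.card_eq_zero.1 h0
    subst this
    have h : (∅ : Finset ι).ssubsets = ∅ := rfl
    simpa [h] using hm ∅
  obtain ⟨s, hs⟩ : ∃ s, B.card = s + 1 := ⟨B.card - 1, by omega⟩
  have hsum : |∑ C ∈ B.ssubsets with C.min = B.min, jointCumulant m C * m (B \ C)|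
      ≤ 2 ^ B.card * 4 ^ (s * s) := by
    calc _ ≤ ∑ C ∈ B.ssubsets with C.min = B.min, |jointCumulant m C * m (B \ C)| :=
          Finset.abs_sum_le_sum_abs _ _
      _ ≤ ∑ C ∈ B.ssubsets with C.min = B.min, (4 : ℝ) ^ (s * s) := by
          refine Finset.sum_le_sum fun C hC => ?_
          have hC' := Finset.mem_ssubsets.1 (Finset.mem_filter.1 hC).1
          have hcard := Finset.card_lt_card hC'
          rw [abs_mul]
          calc _ ≤ |jointCumulant m C| * 1 := by gcongr; exact hm _
            _ ≤ 4 ^ (C.card * C.card) := by rw [mul_one]; exact ih C hC'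
            _ ≤ _ := by
              apply pow_le_pow_right₀ (by norm_num)
              exact Nat.mul_le_mul (by omega) (by omega)
      _ ≤ _ := by
          rw [Finset.sum_const, nsmul_eq_mul]
          gcongr
          exact card_filter_ssubsets_le B _
  calc _ ≤ |m B| + |∑ C ∈ B.ssubsets with C.min = B.min, jointCumulant m C * m (B \ C)| :=
        abs_sub _ _
    _ ≤ 1 + 2 ^ B.card * 4 ^ (s * s) := add_le_add (hm B) hsum
    _ ≤ _ := by rw [hs]; exact one_add_two_pow_mul_four_pow_le s

lemma filter_sdiff_of_subset_filter {B C : Finset ι} (p : ι → Prop) [DecidablePred p]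
    (hC : C ⊆ B.filter p) :
    (B \ C).filter p = B.filter p \ C ∧
      (B \ C).filter (fun i => ¬ p i) = B.filter (fun i => ¬ p i) := by
  constructor
  · ext i; simp; tauto
  · ext i
    have := @hC i
    simp at this ⊢
    tauto

/-- The induction step of `abs_jointCumulant_le_of_factorization`, when the least element of `B`
lies in the part described by `p`. -/
lemma abs_jointCumulant_le_of_factorization_step (m : Finset ι → ℝ) (hm0 : m ∅ = 1)
    (hm : ∀ B, |m B| ≤ 1) (p : ι → Prop) [DecidablePred p] {ε : ℝ} (B : Finset ι)
    (hfac : ∀ T ⊆ B, |m T - m (T.filter p) * m (T.filter (fun i => ¬ p i))| ≤ ε)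
    (hBp : (B.filter p).min = B.min) (hBq : (B.filter (fun i => ¬ p i)).Nonempty)
    (K : ℝ) (hK : (4 : ℝ) ^ ((B.card - 1) * (B.card - 1)) ≤ K)
    (ih : ∀ C ⊂ B, C.min = B.min → (C.filter (fun i => ¬ p i)).Nonempty →
      |jointCumulant m C| ≤ K * ε) :
    |jointCumulant m B| ≤ (1 + 2 ^ B.card * K) * ε := by
  set Bp := B.filter p with hBp'
  set Bq := B.filter (fun i => ¬ p i) with hBq'
  have hε : 0 ≤ ε := (abs_nonneg _).trans (hfac ∅ (by simp))
  have hK0 : 0 ≤ K := le_trans (by positivity) hK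
  -- The recursion for `m Bp` runs over those `C` in the recursion for `m B` that lie inside `Bp`.
  have hpow : Bp.powerset.filter (fun C => C.min = Bp.min)
      = (B.ssubsets.filter (fun C => C.min = B.min)).filter (fun C => C ⊆ Bp) := by
    ext C
    simp only [Finset.mem_filter, Finset.mem_powerset, Finset.mem_ssubsets, hBp]
    constructor
    · rintro ⟨h1, h2⟩
      refine ⟨⟨⟨h1.trans (Finset.filter_subset _ _), fun h => ?_⟩, h2⟩, h1⟩
      obtain ⟨i, hi⟩ := hBq
      have h3 := h1 (h (Finset.mem_filter.1 hi).1)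
      exact (Finset.mem_filter.1 hi).2 (Finset.mem_filter.1 h3).2
    · rintro ⟨⟨h1, h2⟩, h3⟩
      exact ⟨h3, h2⟩
  have hmain : m Bp * m Bq = ∑ C ∈ B.ssubsets with C.min = B.min,
      if C ⊆ Bp then jointCumulant m C * m (Bp \ C) * m Bq else 0 := by
    rw [moment_eq_sum_jointCumulant m hm0 Bp, hpow, Finset.sum_mul, Finset.sum_filter]
  have hdecomp : jointCumulant m B = (m B - m Bp * m Bq)
      - ∑ C ∈ B.ssubsets with C.min = B.min, (jointCumulant m C * m (B \ C)
        - if C ⊆ Bp then jointCumulant m C * m (Bp \ C) * m Bq else 0) := by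
    rw [Finset.sum_sub_distrib, ← hmain, jointCumulant_eq]
    ring
  rw [hdecomp]
  have hterm : ∀ C ∈ B.ssubsets.filter (fun C => C.min = B.min),
      |jointCumulant m C * m (B \ C)
        - if C ⊆ Bp then jointCumulant m C * m (Bp \ C) * m Bq else 0| ≤ K * ε := by
    intro C hC
    obtain ⟨hC1, hC2⟩ := Finset.mem_filter.1 hC
    rw [Finset.mem_ssubsets] at hC1
    split_ifs with h
    · obtain ⟨e1, e2⟩ := filter_sdiff_of_subset_filter p h
      have h1 := hfac (B \ C) Finset.sdiff_subset
      rw [e1, e2] at h1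
      have h2 : |jointCumulant m C| ≤ K := by
        refine (abs_jointCumulant_le m hm C).trans (le_trans ?_ hK)
        have := Finset.card_lt_card hC1
        apply pow_le_pow_right₀ (by norm_num)
        exact Nat.mul_le_mul (by omega) (by omega)
      rw [mul_assoc, ← mul_sub, abs_mul]
      gcongr
    · rw [sub_zero, abs_mul]
      have h3 : (C.filter (fun i => ¬ p i)).Nonempty := by
        obtain ⟨i, hi, hi'⟩ := Finset.not_subset.1 h
        refine ⟨i, Finset.mem_filter.2 ⟨hi, fun hp => hi' ?_⟩⟩
        exact Finset.mem_filter.2 ⟨hC1.1 hi, hp⟩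
      calc _ ≤ |jointCumulant m C| * 1 := by gcongr; exact hm _
        _ ≤ _ := by rw [mul_one]; exact ih C hC1 hC2 h3
  calc _ ≤ |m B - m Bp * m Bq| + |∑ C ∈ B.ssubsets with C.min = B.min,
        (jointCumulant m C * m (B \ C)
        - if C ⊆ Bp then jointCumulant m C * m (Bp \ C) * m Bq else 0)| := abs_sub _ _
    _ ≤ ε + ∑ C ∈ B.ssubsets with C.min = B.min, K * ε :=
        add_le_add (hfac B le_rfl) ((Finset.abs_sum_le_sum_abs _ _).trans
          (Finset.sum_le_sum hterm))
    _ ≤ ε + 2 ^ B.card * (K * ε) := by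
        rw [Finset.sum_const, nsmul_eq_mul]
        gcongr
        exact card_filter_ssubsets_le B _
    _ = _ := by ring

lemma filter_min_eq_of_pos {B : Finset ι} (p : ι → Prop) [DecidablePred p] {a : ι}
    (ha : B.min = a) (hp : p a) : (B.filter p).min = B.min := by
  apply le_antisymm
  · rw [ha]
    exact Finset.min_le (Finset.mem_filter.2 ⟨Finset.mem_of_min ha, hp⟩)
  · exact Finset.min_mono (Finset.filter_subset _ _)

/-- If the moments factor up to an error `ε` along a splitting of the indices into two parts, then
every joint cumulant that involves both parts is of order `ε`. -/
lemma abs_jointCumulant_le_of_factorization (m : Finset ι → ℝ) (hm0 : m ∅ = 1)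
    (hm : ∀ B, |m B| ≤ 1) (p : ι → Prop) [DecidablePred p] {ε : ℝ} (B : Finset ι)
    (hfac : ∀ T ⊆ B, |m T - m (T.filter p) * m (T.filter (fun i => ¬ p i))| ≤ ε)
    (hBp : (B.filter p).Nonempty) (hBq : (B.filter (fun i => ¬ p i)).Nonempty) :
    |jointCumulant m B| ≤ 4 ^ (B.card * B.card) * ε := by
  induction B using Finset.strongInduction with
  | _ B ih =>
  have hε : 0 ≤ ε := (abs_nonneg _).trans (hfac ∅ (by simp))
  have hcard : 2 ≤ B.card := by
    have := Finset.card_filter_add_card_filter_not (s := B) p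
    have := hBp.card_pos
    have := hBq.card_pos
    omega
  have hBne : B.Nonempty := hBp.mono (Finset.filter_subset _ _)
  obtain ⟨a, ha⟩ := Finset.min_of_nonempty hBne
  have hamem : ∀ C : Finset ι, C.min = B.min → a ∈ C := fun C hC =>
    Finset.mem_of_min (hC.trans ha)
  set K : ℝ := 4 ^ ((B.card - 1) * (B.card - 1)) with hKdef
  have hstep : ∀ C ⊂ B, (C.filter p).Nonempty → (C.filter (fun i => ¬ p i)).Nonempty →
      |jointCumulant m C| ≤ K * ε := by
    intro C hC h1 h2
    refine (ih C hC (fun T hT => hfac T (hT.trans hC.1)) h1 h2).trans ?_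
    gcongr
    have := Finset.card_lt_card hC
    apply pow_le_pow_right₀ (by norm_num)
    exact Nat.mul_le_mul (by omega) (by omega)
  have key : |jointCumulant m B| ≤ (1 + 2 ^ B.card * K) * ε := by
    by_cases hp : p a
    · refine abs_jointCumulant_le_of_factorization_step m hm0 hm p B hfac
        (filter_min_eq_of_pos p ha hp) hBq K le_rfl fun C hC hC2 hC3 => ?_
      exact hstep C hC ⟨a, Finset.mem_filter.2 ⟨hamem C hC2, hp⟩⟩ hC3
    · refine abs_jointCumulant_le_of_factorization_step m hm0 hm (fun i => ¬ p i) B ?_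
        (filter_min_eq_of_pos (fun i => ¬ p i) ha hp) (by simpa using hBp) K le_rfl
        fun C hC hC2 hC3 => ?_
      · intro T hT
        simpa [mul_comm] using hfac T hT
      · exact hstep C hC (by simpa using hC3) ⟨a, Finset.mem_filter.2 ⟨hamem C hC2, hp⟩⟩
  refine key.trans ?_
  gcongr
  obtain ⟨s, hs⟩ : ∃ s, B.card = s + 1 := ⟨B.card - 1, by omega⟩
  rw [hKdef, hs]
  simpa using one_add_two_pow_mul_four_pow_le s

/-- The joint cumulant of order `B` involves only the moments of subsets of `B`. -/
lemma jointCumulant_congr {m m' : Finset ι → ℝ} (B : Finset ι) (h : ∀ C ⊆ B, m C = m' C) :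
    jointCumulant m B = jointCumulant m' B := by
  induction B using Finset.strongInduction with
  | _ B ih =>
  rw [jointCumulant_eq, jointCumulant_eq, h B le_rfl]
  congr 1
  refine Finset.sum_congr rfl fun C hC => ?_
  have hC' := Finset.mem_ssubsets.1 (Finset.mem_filter.1 hC).1
  rw [ih C hC' fun D hD => h D (hD.trans hC'.1), h _ Finset.sdiff_subset]

/-- The cumulants of a moment sequence `a`, determined by
`a (k + 1) = ∑_{j ≤ k} (k choose j) * cumulantSeq a (j + 1) * a (k - j)`. The value at `0` is
`1`, a convention without significance. -/
noncomputable def cumulantSeq (a : ℕ → ℝ) : ℕ → ℝ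
  | 0 => 1
  | k + 1 => a (k + 1) - ∑ j : Fin k, (k.choose j : ℝ) * cumulantSeq a (j + 1) * a (k - j)

lemma moment_succ_eq_sum_cumulantSeq (a : ℕ → ℝ) (ha : a 0 = 1) (k : ℕ) :
    a (k + 1) = ∑ j ∈ Finset.range (k + 1),
      (k.choose j : ℝ) * cumulantSeq a (j + 1) * a (k - j) := by
  rw [Finset.sum_range_succ, Nat.sub_self, ha, Nat.choose_self, cumulantSeq,
    Finset.sum_range (n := k)]
  simp

lemma cumulantSeq_one (a : ℕ → ℝ) : cumulantSeq a 1 = a 1 := by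
  rw [cumulantSeq]
  simp

lemma cumulantSeq_two (a : ℕ → ℝ) : cumulantSeq a 2 = a 2 - cumulantSeq a 1 * a 1 := by
  rw [cumulantSeq]
  simp

/-- When the moments depend only on the number of factors, so do the joint cumulants. -/
lemma jointCumulant_eq_cumulantSeq (a : ℕ → ℝ) (B : Finset ι) (hB : B.Nonempty) :
    jointCumulant (fun C => a C.card) B = cumulantSeq a B.card := by
  induction B using Finset.strongInduction with
  | _ B ih =>
  obtain ⟨x, hx⟩ := Finset.min_of_nonempty hB
  have hxB : x ∈ B := Finset.mem_of_min hx
  set D := B.erase x with hD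
  obtain ⟨k, hk⟩ : ∃ k, D.card = k := ⟨_, rfl⟩
  have hBk : B.card = k + 1 := by
    rw [← hk, hD, Finset.card_erase_of_mem hxB]
    have := hB.card_pos
    omega
  have hmin : ∀ C ⊆ B, (C.min = B.min ↔ x ∈ C) := by
    intro C hC
    rw [hx]
    refine ⟨fun h => Finset.mem_of_min h, fun h => le_antisymm (Finset.min_le h) ?_⟩
    rw [← hx]
    exact Finset.min_mono hC
  have hsum : ∑ C ∈ B.ssubsets with C.min = B.min,
      jointCumulant (fun C => a C.card) C * a (B \ C).card
      = ∑ E ∈ D.ssubsets, cumulantSeq a (E.card + 1) * a (k - E.card) := by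
    refine Finset.sum_nbij' (fun C => C.erase x) (fun E => insert x E) ?_ ?_ ?_ ?_ ?_
    · intro C hC
      obtain ⟨h1, h2⟩ := Finset.mem_filter.1 hC
      rw [Finset.mem_ssubsets] at h1 ⊢
      rw [hmin C h1.1] at h2
      refine ⟨Finset.erase_subset_erase x h1.1, fun h => h1.2 ?_⟩
      rw [← Finset.insert_erase hxB, ← Finset.insert_erase h2]
      exact Finset.insert_subset_insert x h
    · intro E hE
      rw [Finset.mem_ssubsets] at hE
      have hxE : x ∉ E := fun h => Finset.notMem_erase x B (hE.1 h)
      have h1 : insert x E ⊂ B := by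
        rw [← Finset.insert_erase hxB]
        refine ⟨Finset.insert_subset_insert x hE.1, fun h => hE.2 fun y hy => ?_⟩
        have hy' := h (Finset.mem_insert_of_mem hy)
        exact (Finset.mem_insert.1 hy').resolve_left (Finset.ne_of_mem_erase hy)
      exact Finset.mem_filter.2 ⟨Finset.mem_ssubsets.2 h1,
        (hmin _ h1.1).2 (Finset.mem_insert_self _ _)⟩
    · intro C hC
      obtain ⟨h1, h2⟩ := Finset.mem_filter.1 hC
      rw [Finset.mem_ssubsets] at h1
      rw [hmin C h1.1] at h2
      exact Finset.insert_erase h2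
    · intro E hE
      rw [Finset.mem_ssubsets] at hE
      exact Finset.erase_insert fun h => Finset.notMem_erase x B (hE.1 h)
    · intro C hC
      obtain ⟨h1, h2⟩ := Finset.mem_filter.1 hC
      rw [Finset.mem_ssubsets] at h1
      rw [hmin C h1.1] at h2
      have hpos := Finset.card_pos.2 ⟨x, h2⟩
      rw [ih C h1 ⟨x, h2⟩, Finset.card_sdiff_of_subset h1.1, Finset.card_erase_of_mem h2, hBk]
      congr 2 <;> omega
  have hpow : ∑ E ∈ D.powerset, cumulantSeq a (E.card + 1) * a (k - E.card)
      = ∑ j ∈ Finset.range (k + 1), (k.choose j : ℝ) * cumulantSeq a (j + 1) * a (k - j) := by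
    rw [Finset.sum_powerset_apply_card (fun j => cumulantSeq a (j + 1) * a (k - j)), hk]
    simp [mul_assoc]
  have herase : ∑ E ∈ D.ssubsets, cumulantSeq a (E.card + 1) * a (k - E.card)
      + cumulantSeq a (k + 1) * a 0
      = ∑ E ∈ D.powerset, cumulantSeq a (E.card + 1) * a (k - E.card) := by
    rw [← Finset.sum_erase_add _ _ (Finset.mem_powerset_self D), hk, Nat.sub_self]
    rfl
  rw [jointCumulant_eq, hsum, hBk]
  rw [hpow, Finset.sum_range_succ, Nat.choose_self, Nat.sub_self] at herase
  have h2 : ∑ E ∈ D.ssubsets, cumulantSeq a (E.card + 1) * a (k - E.card)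
      = ∑ j ∈ Finset.range k, (k.choose j : ℝ) * cumulantSeq a (j + 1) * a (k - j) := by
    simpa using herase
  rw [h2, cumulantSeq, Finset.sum_range (n := k)]

end JointCumulant

/-! ### Multilinearity of joint cumulants -/

section Multilinear

variable {A : Type*} [CommRing A] [Algebra ℝ A] {ι : Type*} [LinearOrder ι]

/-- The joint moments `B ↦ φ (∏ i ∈ B, Y i)` of a family `Y` in a commutative algebra, with respect
to a linear functional `φ` playing the role of the expectation. -/
def jointMoment (φ : A →ₗ[ℝ] ℝ) (Y : ι → A) (B : Finset ι) : ℝ := φ (∏ i ∈ B, Y i)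

lemma jointMoment_update_of_notMem (φ : A →ₗ[ℝ] ℝ) (Y : ι → A) {i : ι} (u : A) {B : Finset ι}
    (hi : i ∉ B) : jointMoment φ (Function.update Y i u) B = jointMoment φ Y B := by
  unfold jointMoment
  congr 1
  refine Finset.prod_congr rfl fun j hj => Function.update_of_ne ?_ _ _
  rintro rfl
  exact hi hj

lemma jointMoment_update_of_mem (φ : A →ₗ[ℝ] ℝ) (Y : ι → A) {i : ι} (u : A) {B : Finset ι}
    (hi : i ∈ B) :
    jointMoment φ (Function.update Y i u) B = φ (u * ∏ j ∈ B.erase i, Y j) := by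
  unfold jointMoment
  rw [← Finset.mul_prod_erase _ _ hi, Function.update_self]
  congr 2
  refine Finset.prod_congr rfl fun j hj => Function.update_of_ne (Finset.ne_of_mem_erase hj) _ _

lemma jointCumulant_update_of_notMem (φ : A →ₗ[ℝ] ℝ) (Y : ι → A) {i : ι} (u : A) {B : Finset ι}
    (hi : i ∉ B) : jointCumulant (jointMoment φ (Function.update Y i u)) B
      = jointCumulant (jointMoment φ Y) B :=
  jointCumulant_congr B fun _ hC => jointMoment_update_of_notMem φ Y u fun h => hi (hC h)

lemma jointCumulant_update_smul_add (φ : A →ₗ[ℝ] ℝ) (Y : ι → A) {i : ι} (c : ℝ) (u v : A)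
    {B : Finset ι} (hi : i ∈ B) :
    jointCumulant (jointMoment φ (Function.update Y i (c • u + v))) B
      = c * jointCumulant (jointMoment φ (Function.update Y i u)) B
        + jointCumulant (jointMoment φ (Function.update Y i v)) B := by
  have hmom : ∀ C, i ∈ C → jointMoment φ (Function.update Y i (c • u + v)) C
      = c * jointMoment φ (Function.update Y i u) C + jointMoment φ (Function.update Y i v) C := by
    intro C hC
    rw [jointMoment_update_of_mem φ Y _ hC, jointMoment_update_of_mem φ Y _ hC,
      jointMoment_update_of_mem φ Y _ hC, add_mul, map_add, smul_mul_assoc, map_smul, smul_eq_mul]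
  induction B using Finset.strongInduction with
  | _ B ih =>
  rw [jointCumulant_eq, jointCumulant_eq, jointCumulant_eq, hmom B hi]
  have : ∑ C ∈ B.ssubsets with C.min = B.min,
      jointCumulant (jointMoment φ (Function.update Y i (c • u + v))) C
        * jointMoment φ (Function.update Y i (c • u + v)) (B \ C)
      = c * ∑ C ∈ B.ssubsets with C.min = B.min,
        jointCumulant (jointMoment φ (Function.update Y i u)) C
          * jointMoment φ (Function.update Y i u) (B \ C)
      + ∑ C ∈ B.ssubsets with C.min = B.min,
        jointCumulant (jointMoment φ (Function.update Y i v)) C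
          * jointMoment φ (Function.update Y i v) (B \ C) := by
    rw [Finset.mul_sum, ← Finset.sum_add_distrib]
    refine Finset.sum_congr rfl fun C hC => ?_
    have hC' := Finset.mem_ssubsets.1 (Finset.mem_filter.1 hC).1
    by_cases hiC : i ∈ C
    · have hn : i ∉ B \ C := by simp [hiC]
      rw [ih C hC' hiC]
      simp only [jointMoment_update_of_notMem φ Y _ hn]
      ring
    · have hn : i ∈ B \ C := by simp [hi, hiC]
      rw [hmom _ hn]
      simp only [jointCumulant_update_of_notMem φ Y _ hiC]
      ring
  rw [this]
  ring

/-- The joint cumulant of all the members of a finite family, as a multilinear map. -/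
noncomputable def jointCumulantMultilinear [Fintype ι] (φ : A →ₗ[ℝ] ℝ) :
    MultilinearMap ℝ (fun _ : ι => A) ℝ where
  toFun Y := jointCumulant (jointMoment φ Y) Finset.univ
  map_update_add' {inst} Y i u v := by
    rw [Subsingleton.elim inst LinearOrder.toDecidableEq]
    simpa using jointCumulant_update_smul_add φ Y 1 u v (Finset.mem_univ i)
  map_update_smul' {inst} Y i c u := by
    rw [Subsingleton.elim inst LinearOrder.toDecidableEq]
    have h0 := jointCumulant_update_smul_add φ Y 1 0 0 (Finset.mem_univ i)
    have h := jointCumulant_update_smul_add φ Y c u 0 (Finset.mem_univ i)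
    simp only [add_zero, one_smul, one_mul, left_eq_add] at h0 h
    simpa [h0] using h

/-- The cumulant of order `k` of a sum is the sum of the joint cumulants over all `k`-tuples of
summands. -/
lemma cumulantSeq_sum {J : Type*} [Fintype J] [DecidableEq J] (φ : A →ₗ[ℝ] ℝ) (W : J → A) (k : ℕ)
    (hk : 1 ≤ k) :
    cumulantSeq (fun l => φ ((∑ j, W j) ^ l)) k
      = ∑ w : Fin k → J, jointCumulant (jointMoment φ (fun i => W (w i))) Finset.univ := by
  have h := (jointCumulantMultilinear (ι := Fin k) φ).map_sum (fun (_ : Fin k) j => W j)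
  have hne : (Finset.univ : Finset (Fin k)).Nonempty := ⟨⟨0, hk⟩, Finset.mem_univ _⟩
  have h2 := jointCumulant_eq_cumulantSeq (fun l => φ ((∑ j, W j) ^ l)) _ hne
  rw [Finset.card_univ, Fintype.card_fin] at h2
  rw [← h2]
  refine Eq.trans ?_ h
  refine jointCumulant_congr _ fun C _ => ?_
  simp [jointMoment]

end Multilinear

/-! ### Covariance bounds from absolute regularity -/

/-- If two probability measures differ by at most `s` on every event, then the integrals of a
function bounded by `M` differ by at most `2 M s`. -/
lemma abs_integral_sub_integral_le {E : Type*} [MeasurableSpace E] (μ ν : Measure E)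
    [IsProbabilityMeasure μ] [IsProbabilityMeasure ν] {g : E → ℝ} (hg : Measurable g) {M s : ℝ}
    (hM0 : 0 ≤ M) (hM : ∀ x, |g x| ≤ M)
    (hs : ∀ A, MeasurableSet A → |μ.real A - ν.real A| ≤ s) :
    |∫ x, g x ∂μ - ∫ x, g x ∂ν| ≤ 2 * M * s := by
  set h : E → ℝ := fun x => g x + M with hh
  have hhm : Measurable h := hg.add_const M
  have h0 : ∀ x, 0 ≤ h x := fun x => by have := (abs_le.1 (hM x)).1; simp only [hh]; linarith
  have h1 : ∀ x, h x ≤ 2 * M := fun x => by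
    have := (abs_le.1 (hM x)).2; simp only [hh]; linarith
  have hint : ∀ (ρ : Measure E) [IsProbabilityMeasure ρ], Integrable g ρ := fun ρ _ =>
    Integrable.of_bound hg.aestronglyMeasurable M (ae_of_all _ hM)
  have key : ∀ (ρ : Measure E) [IsProbabilityMeasure ρ],
      ∫ x, g x ∂ρ = (∫ t in Set.Ioc 0 (2 * M), ρ.real {a | t ≤ h a}) - M ∧
      IntegrableOn (fun t => ρ.real {a | t ≤ h a}) (Set.Ioc 0 (2 * M)) := by
    intro ρ _
    constructor
    · have hhi : Integrable h ρ := (hint ρ).add (integrable_const M)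
      rw [← hhi.integral_eq_integral_Ioc_meas_le (ae_of_all _ h0) (ae_of_all _ h1),
        integral_add (hint ρ) (integrable_const M)]
      simp
    · have hanti : Antitone fun t => ρ.real {a | t ≤ h a} := fun a b hab =>
        measureReal_mono fun x hx => hab.trans hx
      exact ((hanti.antitoneOn _).integrableOn_isCompact isCompact_Icc).mono_set
        Set.Ioc_subset_Icc_self
  rw [(key μ).1, (key ν).1, sub_sub_sub_cancel_right, ← integral_sub (key μ).2 (key ν).2]
  have := norm_setIntegral_le_of_norm_le_const (μ := volume) (s := Set.Ioc 0 (2 * M))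
    (f := fun t => μ.real {a | t ≤ h a} - ν.real {a | t ≤ h a}) (C := s) measure_Ioc_lt_top
    (fun t _ => hs _ (hhm measurableSet_Ici))
  rw [Real.norm_eq_abs] at this
  refine this.trans (le_of_eq ?_)
  rw [Measure.real, Real.volume_Ioc, sub_zero, ENNReal.toReal_ofReal (by linarith), mul_comm]

lemma abs_integral_le_one {E : Type*} [MeasurableSpace E] (ρ : Measure E) [IsProbabilityMeasure ρ]
    {g : E → ℝ} (hg : ∀ x, |g x| ≤ 1) : |∫ x, g x ∂ρ| ≤ 1 := by
  have := norm_integral_le_of_norm_le_const (μ := ρ) (f := g) (C := 1) (ae_of_all _ hg)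
  simpa using this

lemma integrable_of_abs_le_one {E : Type*} [MeasurableSpace E] (ρ : Measure E) [IsFiniteMeasure ρ]
    {g : E → ℝ} (hgm : Measurable g) (hg : ∀ x, |g x| ≤ 1) : Integrable g ρ :=
  Integrable.of_bound hgm.aestronglyMeasurable 1 (ae_of_all _ hg)

/-- The path that follows `x` up to time `k` and then continues from time `l` on with `y`. The
values strictly between `k` and `l` carry no information. -/
def splicePath (k l : ℕ) (z : (Fin (k + 1) → ℝ) × (ℕ → ℝ)) (t : ℕ) : ℝ :=
  if h : t < k + 1 then z.1 ⟨t, h⟩ else z.2 (t - l)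

lemma measurable_splicePath (k l : ℕ) : Measurable (splicePath k l) := by
  refine measurable_pi_lambda _ fun t => ?_
  unfold splicePath
  split_ifs with h
  · exact (measurable_pi_apply _).comp measurable_fst
  · exact (measurable_pi_apply _).comp measurable_snd

lemma splicePath_past {Ω : Type*} {X : ℕ → Ω → ℝ} (k l : ℕ) (ω : Ω) (y : ℕ → ℝ) {t : ℕ}
    (ht : t ≤ k) :
    splicePath k l (past X k ω, y) t = X t ω := by
  simp [splicePath, past, Nat.lt_succ_of_le ht]

lemma splicePath_future {Ω : Type*} {X : ℕ → Ω → ℝ} (k m : ℕ)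
    (x : Fin (k + 1) → ℝ) (ω : Ω) (hm : 1 ≤ m) {t : ℕ}
    (ht : k + m ≤ t) : splicePath k (k + m) (x, future X (k + m) ω) t = X t ω := by
  have h : ¬ t < k + 1 := by omega
  simp only [splicePath, h, dite_false, future]
  congr 1
  omega

section Mixing

variable {Ω : Type*} [MeasurableSpace Ω] (μ : Measure Ω) [IsProbabilityMeasure μ]
  {X : ℕ → Ω → ℝ}

lemma measurable_past (hX : ∀ t, Measurable (X t)) (k : ℕ) : Measurable (past X k) :=
  measurable_pi_lambda _ fun i => hX i

lemma measurable_future (hX : ∀ t, Measurable (X t)) (l : ℕ) : Measurable (future X l) :=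
  measurable_pi_lambda _ fun s => hX (l + s)

/-- The conditional total variation distance is at most one. -/
lemma iSup_ofReal_abs_le_one (k m : ℕ) (ω : Ω) :
    (⨆ (A : Set (ℕ → ℝ)) (_ : MeasurableSet A), ENNReal.ofReal
      |(condDistrib (future X (k + m)) (past X k) μ (past X k ω)).real A
        - μ.real (future X (k + m) ⁻¹' A)|) ≤ 1 := by
  refine iSup₂_le fun A _ => ?_
  rw [ENNReal.ofReal_le_one, abs_le]
  have h1 := measureReal_nonneg (μ := condDistrib (future X (k + m)) (past X k) μ (past X k ω))
    (s := A)
  have h2 := measureReal_nonneg (μ := μ) (s := future X (k + m) ⁻¹' A)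
  have h3 := measureReal_le_one (μ := condDistrib (future X (k + m)) (past X k) μ (past X k ω))
    (s := A)
  have h4 := measureReal_le_one (μ := μ) (s := future X (k + m) ⁻¹' A)
  constructor <;> linarith

lemma absRegCoeff_nonneg (m : ℕ) : 0 ≤ absRegCoeff μ X m := ENNReal.toReal_nonneg

lemma lintegral_iSup_le_absRegCoeff (k m : ℕ) :
    ∫⁻ ω, ⨆ (A : Set (ℕ → ℝ)) (_ : MeasurableSet A), ENNReal.ofReal
      |(condDistrib (future X (k + m)) (past X k) μ (past X k ω)).real A
        - μ.real (future X (k + m) ⁻¹' A)| ∂μ ≤ ENNReal.ofReal (absRegCoeff μ X m) := by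
  unfold absRegCoeff
  rw [ENNReal.ofReal_toReal]
  · exact le_iSup (fun k => ∫⁻ ω, ⨆ (A : Set (ℕ → ℝ)) (_ : MeasurableSet A), ENNReal.ofReal
      |(condDistrib (future X (k + m)) (past X k) μ (past X k ω)).real A
        - μ.real (future X (k + m) ⁻¹' A)| ∂μ) k
  · refine ne_top_of_le_ne_top ENNReal.one_ne_top (iSup_le fun k => ?_)
    refine (lintegral_mono fun ω => iSup_ofReal_abs_le_one μ k m ω).trans ?_
    simp

/-- Replacing the future by an independent copy changes the expectation of a function of the past
and the future by at most twice the absolute regularity coefficient. -/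
lemma abs_integral_past_future_sub_le (hX : ∀ t, Measurable (X t)) (k m : ℕ)
    {Φ : (Fin (k + 1) → ℝ) × (ℕ → ℝ) → ℝ} (hΦ : Measurable Φ) (hb : ∀ z, |Φ z| ≤ 1) :
    |∫ ω, Φ (past X k ω, future X (k + m) ω) ∂μ
      - ∫ ω, ∫ ω', Φ (past X k ω, future X (k + m) ω') ∂μ ∂μ| ≤ 2 * absRegCoeff μ X m := by
  set p := past X k with hp
  set q := future X (k + m) with hq
  have hpm : Measurable p := measurable_past hX k
  have hqm : Measurable q := measurable_future hX _
  set κ := condDistrib q p μ with hκ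
  have h1 : ∫ ω, Φ (p ω, q ω) ∂μ = ∫ ω, ∫ y, Φ (p ω, y) ∂(κ (p ω)) ∂μ := by
    have e1 : ∫ ω, Φ (p ω, q ω) ∂μ = ∫ z, Φ z ∂(μ.map fun a => (p a, q a)) := by
      rw [integral_map (hpm.prodMk hqm).aemeasurable hΦ.aestronglyMeasurable]
    rw [e1, ← compProd_map_condDistrib hqm.aemeasurable, Measure.integral_compProd,
      integral_map hpm.aemeasurable]
    · exact (hΦ.stronglyMeasurable.integral_kernel_prod_right').aestronglyMeasurable
    · exact Integrable.of_bound hΦ.aestronglyMeasurable 1 (ae_of_all _ hb)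
  have h2 : ∀ ω, ∫ ω', Φ (p ω, q ω') ∂μ = ∫ y, Φ (p ω, y) ∂(μ.map q) := fun ω => by
    rw [integral_map hqm.aemeasurable]
    exact (hΦ.comp measurable_prodMk_left).aestronglyMeasurable
  have : IsProbabilityMeasure (μ.map q) := Measure.isProbabilityMeasure_map hqm.aemeasurable
  have hm1 : Measurable fun x => ∫ y, Φ (x, y) ∂(κ x) :=
    (hΦ.stronglyMeasurable.integral_kernel_prod_right').measurable
  have hm2 : Measurable fun x => ∫ y, Φ (x, y) ∂(μ.map q) :=
    (hΦ.stronglyMeasurable.integral_prod_right').measurable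
  have hi1 : Integrable (fun ω => ∫ y, Φ (p ω, y) ∂(κ (p ω))) μ :=
    Integrable.of_bound (hm1.comp hpm).aestronglyMeasurable 1
      (ae_of_all _ fun ω => abs_integral_le_one _ fun y => hb _)
  have hi2 : Integrable (fun ω => ∫ y, Φ (p ω, y) ∂(μ.map q)) μ :=
    Integrable.of_bound (hm2.comp hpm).aestronglyMeasurable 1
      (ae_of_all _ fun ω => abs_integral_le_one _ fun y => hb _)
  rw [h1]
  simp_rw [h2]
  rw [← integral_sub hi1 hi2]
  set S : Ω → ENNReal := fun ω => ⨆ (A : Set (ℕ → ℝ)) (_ : MeasurableSet A), ENNReal.ofReal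
      |(κ (p ω)).real A - μ.real (q ⁻¹' A)| with hS
  have hS1 : ∀ ω, S ω ≤ 1 := fun ω => iSup_ofReal_abs_le_one μ k m ω
  have hpt : ∀ ω, ‖∫ y, Φ (p ω, y) ∂(κ (p ω)) - ∫ y, Φ (p ω, y) ∂(μ.map q)‖ₑ ≤ 2 * S ω := by
    intro ω
    have hne : S ω ≠ ⊤ := ne_top_of_le_ne_top ENNReal.one_ne_top (hS1 ω)
    have h3 := abs_integral_sub_integral_le (κ (p ω)) (μ.map q) (g := fun y => Φ (p ω, y))
      (hΦ.comp measurable_prodMk_left) zero_le_one (fun y => hb _) (s := (S ω).toReal) (by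
        intro A hA
        rw [map_measureReal_apply hqm hA, ← ENNReal.ofReal_le_iff_le_toReal hne]
        exact le_iSup₂_of_le A hA le_rfl)
    rw [← ofReal_norm, Real.norm_eq_abs]
    refine (ENNReal.ofReal_le_ofReal h3).trans (le_of_eq ?_)
    rw [ENNReal.ofReal_mul (by norm_num), ENNReal.ofReal_toReal hne]
    norm_num
  have hfin : ‖∫ ω, (∫ y, Φ (p ω, y) ∂(κ (p ω)) - ∫ y, Φ (p ω, y) ∂(μ.map q)) ∂μ‖ₑ
      ≤ 2 * ENNReal.ofReal (absRegCoeff μ X m) := by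
    refine (enorm_integral_le_lintegral_enorm _).trans ((lintegral_mono hpt).trans ?_)
    rw [lintegral_const_mul' _ _ (by norm_num)]
    gcongr
    exact lintegral_iSup_le_absRegCoeff μ k m
  rw [← Real.norm_eq_abs, ← ENNReal.ofReal_le_ofReal_iff
    (mul_nonneg zero_le_two (absRegCoeff_nonneg μ m)), ofReal_norm,
    ENNReal.ofReal_mul zero_le_two]
  simpa using hfin

/-- The induction step of `abs_covariance_le_absRegCoeff`: when `G` looks at times later than all
the times `≤ u` that `H` looks at, these later times are decoupled from the rest at the cost `4 β`,
and what remains is a covariance in which `G` has lost at least one time. -/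
lemma abs_covariance_step (hX : ∀ t, Measurable (X t)) {m : ℕ} (hm : 1 ≤ m) (u : ℕ)
    (I I' : Finset ℕ) {G H : (ℕ → ℝ) → ℝ} (hG : Measurable G) (hH : Measurable H)
    (hG1 : ∀ x, |G x| ≤ 1) (hH1 : ∀ x, |H x| ≤ 1) (hGI : DependsOn G (I : Set ℕ))
    (hHI : DependsOn H (I' : Set ℕ)) (hI : ∀ t ∈ I, t ≤ u ∨ u + m ≤ t) (hI' : ∀ t ∈ I', t ≤ u)
    {C : ℝ} (ih : ∀ G' : (ℕ → ℝ) → ℝ, Measurable G' → (∀ x, |G' x| ≤ 1) →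
      DependsOn G' (I.filter (fun t => t ≤ u) : Set ℕ) →
      |∫ ω, G' (fun t => X t ω) * H (fun t => X t ω) ∂μ
        - (∫ ω, G' (fun t => X t ω) ∂μ) * ∫ ω, H (fun t => X t ω) ∂μ| ≤ C) :
    |∫ ω, G (fun t => X t ω) * H (fun t => X t ω) ∂μ
        - (∫ ω, G (fun t => X t ω) ∂μ) * ∫ ω, H (fun t => X t ω) ∂μ|
      ≤ C + 4 * absRegCoeff μ X m := by
  set β := absRegCoeff μ X m with hβ
  have hξ : Measurable fun ω t => X t ω := measurable_pi_lambda _ hX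
  set s := splicePath u (u + m) with hs
  have hsm : Measurable s := measurable_splicePath _ _
  set p := past X u with hp
  set q := future X (u + m) with hq
  have hpm : Measurable p := measurable_past hX u
  have hqm : Measurable q := measurable_future hX _
  have hGs : ∀ ω, G (s (p ω, q ω)) = G (fun t => X t ω) := fun ω => hGI fun t ht => by
    rcases hI t ht with h | h
    · exact splicePath_past _ _ _ _ h
    · exact splicePath_future _ _ _ _ hm h
  have hHs : ∀ ω y, H (s (p ω, y)) = H (fun t => X t ω) := fun ω y => hHI fun t ht =>
    splicePath_past _ _ _ _ (hI' t ht)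
  have hmul : ∀ {a b : ℝ}, |a| ≤ 1 → |b| ≤ 1 → |a * b| ≤ 1 := fun ha hb => by
    rw [abs_mul]; exact mul_le_one₀ ha (abs_nonneg _) hb
  -- Both `E G H` and `E G` change by at most `2 β` when the future is
  -- replaced by an independent copy.
  have h1 := abs_integral_past_future_sub_le μ hX u m (Φ := fun z => G (s z) * H (s z))
    ((hG.comp hsm).mul (hH.comp hsm)) (fun z => hmul (hG1 _) (hH1 _))
  have h2 := abs_integral_past_future_sub_le μ hX u m (Φ := fun z => G (s z))
    (hG.comp hsm) (fun z => hG1 _)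
  simp only [← hp, ← hq, hGs, hHs] at h1 h2
  set EH := ∫ ω, H (fun t => X t ω) ∂μ with hEH
  have hmix : Measurable fun z : Ω × Ω => G (s (p z.1, q z.2)) :=
    hG.comp (hsm.comp ((hpm.comp measurable_fst).prodMk (hqm.comp measurable_snd)))
  have hHm : Measurable fun ω => H (fun t => X t ω) := hH.comp hξ
  have hmixH : Measurable fun z : Ω × Ω => G (s (p z.1, q z.2)) * H (fun t => X t z.1) :=
    hmix.mul (hHm.comp measurable_fst)
  have hEH1 : |EH| ≤ 1 := abs_integral_le_one μ fun ω => hH1 _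
  have hsw1 := integral_integral_swap (f := fun ω ω' => G (s (p ω, q ω')) * H (fun t => X t ω))
    (integrable_of_abs_le_one (μ.prod μ) (g := Function.uncurry _) hmixH
      fun z => hmul (hG1 _) (hH1 _))
  have hsw2 := integral_integral_swap (f := fun ω ω' => G (s (p ω, q ω')))
    (integrable_of_abs_le_one (μ.prod μ) (g := Function.uncurry _) hmix fun z => hG1 _)
  rw [hsw1] at h1
  rw [hsw2] at h2
  -- With the copy of the future fixed, `ih` applies to `G` as a function of the past.
  have h3 : |(∫ ω', ∫ ω, G (s (p ω, q ω')) * H (fun t => X t ω) ∂μ ∂μ)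
      - (∫ ω', ∫ ω, G (s (p ω, q ω')) ∂μ ∂μ) * EH| ≤ C := by
    have i1 : Integrable (fun ω' => ∫ ω, G (s (p ω, q ω')) * H (fun t => X t ω) ∂μ) μ := by
      refine integrable_of_abs_le_one μ ?_ fun ω' => abs_integral_le_one μ fun ω =>
        hmul (hG1 _) (hH1 _)
      exact (hmixH.comp measurable_swap).stronglyMeasurable.integral_prod_right'.measurable
    have i2 : Integrable (fun ω' => ∫ ω, G (s (p ω, q ω')) ∂μ) μ := by
      refine integrable_of_abs_le_one μ ?_ fun ω' => abs_integral_le_one μ fun ω => hG1 _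
      exact (hmix.comp measurable_swap).stronglyMeasurable.integral_prod_right'.measurable
    rw [← integral_mul_const, ← integral_sub i1 (i2.mul_const _)]
    have h4 : ∀ ω', ‖(∫ ω, G (s (p ω, q ω')) * H (fun t => X t ω) ∂μ)
        - (∫ ω, G (s (p ω, q ω')) ∂μ) * EH‖ ≤ C := by
      intro ω'
      set G' : (ℕ → ℝ) → ℝ := fun x => G (fun t => if t ≤ u then x t else q ω' (t - (u + m)))
        with hG'
      have e : ∀ ω, G (s (p ω, q ω')) = G' (fun t => X t ω) := by
        intro ω
        simp only [hG']
        congr 1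
        ext t
        simp only [hs, splicePath, hp, past, Nat.lt_succ_iff]
        split_ifs <;> rfl
      simp only [e]
      refine ih G' ?_ (fun x => hG1 _) ?_
      · refine hG.comp (measurable_pi_lambda _ fun t => ?_)
        split_ifs
        · exact measurable_pi_apply t
        · exact measurable_const
      · intro x y hxy
        refine hGI fun t ht => ?_
        split_ifs with h
        · exact hxy t (by simpa using ⟨ht, h⟩)
        · rfl
    have := norm_integral_le_of_norm_le_const (μ := μ) (ae_of_all _ h4)
    simpa using this
  have h5 : |(∫ ω', ∫ ω, G (s (p ω, q ω')) ∂μ ∂μ) * EH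
      - (∫ ω, G (fun t => X t ω) ∂μ) * EH| ≤ 2 * β := by
    rw [← sub_mul, abs_mul, abs_sub_comm]
    calc _ ≤ (2 * β) * 1 := by
          gcongr
          exact mul_nonneg zero_le_two (absRegCoeff_nonneg μ m)
      _ = _ := mul_one _
  rw [abs_le] at *
  constructor <;> linarith [h1.1, h1.2, h3.1, h3.2, h5.1, h5.2]

/-- Functions of two groups of times that are at distance at least `m` from each other are nearly
uncorrelated, even when the two groups interlace. -/
lemma abs_covariance_le_absRegCoeff (hX : ∀ t, Measurable (X t)) {m : ℕ} (hm : 1 ≤ m)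
    (I I' : Finset ℕ) {G H : (ℕ → ℝ) → ℝ} (hG : Measurable G) (hH : Measurable H)
    (hG1 : ∀ x, |G x| ≤ 1) (hH1 : ∀ x, |H x| ≤ 1) (hGI : DependsOn G (I : Set ℕ))
    (hHI : DependsOn H (I' : Set ℕ)) (hsep : ∀ s ∈ I, ∀ t ∈ I', s + m ≤ t ∨ t + m ≤ s) :
    |∫ ω, G (fun t => X t ω) * H (fun t => X t ω) ∂μ
        - (∫ ω, G (fun t => X t ω) ∂μ) * ∫ ω, H (fun t => X t ω) ∂μ|
      ≤ 4 * (I.card + I'.card : ℕ) * absRegCoeff μ X m := by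
  have hβ := absRegCoeff_nonneg μ (X := X) m
  obtain ⟨N, hN⟩ : ∃ N, I.card + I'.card = N := ⟨_, rfl⟩
  rw [hN]
  induction N using Nat.strong_induction_on generalizing I I' G H with
  | _ N ih =>
  rcases I.eq_empty_or_nonempty with rfl | hne
  · have hc : ∀ x, G x = G 0 := fun x => hGI (by simp)
    simp only [hc (fun t => X t _), integral_const_mul]
    simp only [integral_const, probReal_univ, smul_eq_mul, one_mul, sub_self, abs_zero]
    positivity
  rcases I'.eq_empty_or_nonempty with rfl | hne'
  · have hc : ∀ x, H x = H 0 := fun x => hHI (by simp)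
    simp only [hc (fun t => X t _), integral_mul_const]
    simp only [integral_const, probReal_univ, smul_eq_mul, one_mul, sub_self, abs_zero]
    positivity
  have hstep : ∀ (I I' : Finset ℕ) {G H : (ℕ → ℝ) → ℝ}, Measurable G → Measurable H →
      (∀ x, |G x| ≤ 1) → (∀ x, |H x| ≤ 1) → DependsOn G (I : Set ℕ) →
      DependsOn H (I' : Set ℕ) → (∀ s ∈ I, ∀ t ∈ I', s + m ≤ t ∨ t + m ≤ s) →
      I.card + I'.card = N → (hne' : I'.Nonempty) → (∃ t ∈ I, I'.max' hne' < t) →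
      |∫ ω, G (fun t => X t ω) * H (fun t => X t ω) ∂μ
        - (∫ ω, G (fun t => X t ω) ∂μ) * ∫ ω, H (fun t => X t ω) ∂μ|
      ≤ 4 * N * absRegCoeff μ X m := by
    intro I I' G H hG hH hG1 hH1 hGI hHI hsep hN hne' ⟨t, htI, ht⟩
    set u := I'.max' hne' with hu
    have hcard : (I.filter (fun t => t ≤ u)).card < I.card :=
      Finset.card_lt_card (Finset.filter_ssubset.2 ⟨t, htI, by omega⟩)
    have h := abs_covariance_step μ hX hm u I I' hG hH hG1 hH1 hGI hHI
      (fun s hs => by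
        have := hsep s hs u (I'.max'_mem hne')
        omega)
      (fun s hs => I'.le_max' s hs) (C := 4 * (N - 1 : ℕ) * absRegCoeff μ X m)
      (fun G' hG' hG'1 hG'I => by
        refine (ih _ (by omega) _ I' hG' hH hG'1 hH1 hG'I hHI
          (fun s hs => hsep s (Finset.mem_filter.1 hs).1) rfl).trans ?_
        gcongr
        omega)
    have hNN : ((N - 1 : ℕ) : ℝ) = N - 1 := by
      rw [Nat.cast_sub (by omega)]
      simp
    rw [hNN] at h
    linarith
  have hlt : I'.max' hne' < I.max' hne ∨ I.max' hne < I'.max' hne' := by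
    have := hsep _ (I.max'_mem hne) _ (I'.max'_mem hne')
    omega
  rcases hlt with h | h
  · exact hstep I I' hG hH hG1 hH1 hGI hHI hsep hN hne' ⟨_, I.max'_mem hne, h⟩
  · have := hstep I' I hH hG hH1 hG1 hHI hGI (fun s hs t ht => (hsep t ht s hs).symm)
      (by omega) hne ⟨_, I'.max'_mem hne', h⟩
    simpa only [mul_comm] using this

end Mixing

/-! ### Counting connected tuples -/

section Counting

variable {J : Type*}

/-- The graph on the positions of a tuple `w` in which two positions are joined when their
entries are related by `R`. -/
def tupleGraph (R : J → J → Prop) {k : ℕ} (w : Fin k → J) : SimpleGraph (Fin k) :=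
  SimpleGraph.fromRel fun p q => R (w p) (w q)

lemma tupleGraph_succAbove_connected (R : J → J → Prop) {k : ℕ} (w : Fin (k + 1) → J)
    (v : Fin (k + 1)) (h : ((tupleGraph R w).induce {v}ᶜ).Connected) :
    (tupleGraph R (fun i => w (v.succAbove i))).Connected := by
  let e : tupleGraph R (fun i => w (v.succAbove i)) ≃g (tupleGraph R w).induce {v}ᶜ :=
    { toEquiv := finSuccAboveEquiv v
      map_rel_iff' := by
        intro a b
        change (tupleGraph R w).Adj (v.succAbove a) (v.succAbove b) ↔ _
        simp [tupleGraph] }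
  exact e.connected_iff.2 h

open Classical in
/-- A connected graph stays connected when a suitable vertex is removed; hence a connected
`(k + 2)`-tuple arises from a connected `(k + 1)`-tuple by inserting, at some position, an entry
related to one of the others. -/
lemma card_connected_succ_le [Fintype J] (R : J → J → Prop) (hR : ∀ a b, R a b → R b a) (D : ℕ)
    (hD : ∀ a, (Finset.univ.filter (R a)).card ≤ D) (k : ℕ) :
    (Finset.univ.filter fun w : Fin (k + 2) → J => (tupleGraph R w).Connected).card
      ≤ (k + 2) * ((k + 1) * (D *
        (Finset.univ.filter fun w : Fin (k + 1) → J => (tupleGraph R w).Connected).card)) := by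
  set S := Finset.univ.filter fun w : Fin (k + 1) → J => (tupleGraph R w).Connected with hS
  have hsub : (Finset.univ.filter fun w : Fin (k + 2) → J => (tupleGraph R w).Connected)
      ⊆ Finset.univ.biUnion fun v : Fin (k + 2) => Finset.univ.biUnion fun u : Fin (k + 1) =>
        (S.sigma fun w' => Finset.univ.filter (R (w' u))).image
          fun z => v.insertNth z.2 z.1 := by
    intro w hw
    have hw' := (Finset.mem_filter.1 hw).2
    obtain ⟨v, hv⟩ := hw'.exists_connected_induce_compl_singleton_of_finite_nontrivial
    obtain ⟨x, hx⟩ := hw'.preconnected.exists_adj_of_nontrivial v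
    have hxv : x ≠ v := hx.ne'
    obtain ⟨u, rfl⟩ := Fin.exists_succAbove_eq hxv
    have hRux : R (w (v.succAbove u)) (w v) := by
      have h := hx
      rw [tupleGraph, SimpleGraph.fromRel_adj] at h
      exact h.2.elim (hR _ _) id
    simp only [Finset.mem_biUnion, Finset.mem_univ, true_and, Finset.mem_image, Finset.mem_sigma]
    refine ⟨v, u, ⟨fun i => w (v.succAbove i), w v⟩, ⟨?_, ?_⟩, ?_⟩
    · exact Finset.mem_filter.2 ⟨Finset.mem_univ _, tupleGraph_succAbove_connected R w v hv⟩
    · exact Finset.mem_filter.2 ⟨Finset.mem_univ _, hRux⟩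
    · exact Fin.insertNth_self_removeNth v w
  refine (Finset.card_le_card hsub).trans (Finset.card_biUnion_le.trans ?_)
  refine (Finset.sum_le_card_nsmul _ _ ((k + 1) * (D * S.card)) fun v _ => ?_).trans (by simp)
  refine Finset.card_biUnion_le.trans ?_
  refine (Finset.sum_le_card_nsmul _ _ (D * S.card) fun u _ => ?_).trans (by simp)
  refine Finset.card_image_le.trans ?_
  rw [Finset.card_sigma]
  exact (Finset.sum_le_card_nsmul _ _ D fun w _ => hD _).trans (by simp [mul_comm])

open Classical in
lemma card_connected_le [Fintype J] (R : J → J → Prop) (hR : ∀ a b, R a b → R b a) (D : ℕ)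
    (hD : ∀ a, (Finset.univ.filter (R a)).card ≤ D) (k : ℕ) :
    (Finset.univ.filter fun w : Fin (k + 1) → J => (tupleGraph R w).Connected).card
      ≤ (k + 1).factorial ^ 2 * (D ^ k * Fintype.card J) := by
  induction k with
  | zero =>
    refine (Finset.card_filter_le _ _).trans ?_
    simp
  | succ k ih =>
    refine (card_connected_succ_le R hR D hD k).trans ?_
    calc _ ≤ (k + 2) * ((k + 2) * (D * ((k + 1).factorial ^ 2 * (D ^ k * Fintype.card J)))) := by
          gcongr
          omega
      _ = _ := by
          rw [Nat.factorial_succ (k + 1)]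
          ring

/-- The positions of a tuple that is not connected split into two nonempty parts such that no entry
from one part is related to an entry from the other. -/
lemma exists_split_of_not_connected (R : J → J → Prop) {k : ℕ} (hk : 1 ≤ k) (w : Fin k → J)
    (h : ¬ (tupleGraph R w).Connected) :
    ∃ p : Fin k → Prop, (∃ i, p i) ∧ (∃ i, ¬ p i) ∧ ∀ a b, p a → ¬ p b → ¬ R (w a) (w b) := by
  have : Nonempty (Fin k) := ⟨⟨0, hk⟩⟩
  have h' : ¬ (tupleGraph R w).Preconnected := fun hc => h ⟨hc⟩
  simp only [SimpleGraph.Preconnected, not_forall] at h'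
  obtain ⟨u, v, huv⟩ := h'
  refine ⟨fun x => (tupleGraph R w).Reachable u x, ⟨u, SimpleGraph.Reachable.refl _⟩, ⟨v, huv⟩,
    fun a b ha hb hab => hb (ha.trans (SimpleGraph.Adj.reachable ?_))⟩
  rw [tupleGraph, SimpleGraph.fromRel_adj]
  exact ⟨fun e => hb (e ▸ ha), Or.inl hab⟩

/-- Two index tuples are close when some entry of the first is at distance less than `m` from some
entry of the second. -/
def IsClose {n r : ℕ} (m : ℕ) (i j : Fin r → Fin n) : Prop :=
  ∃ a b, (i a : ℕ) < j b + m ∧ (j b : ℕ) < i a + m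

lemma IsClose.symm {n r m : ℕ} {i j : Fin r → Fin n} (h : IsClose m i j) : IsClose m j i := by
  obtain ⟨a, b, h1, h2⟩ := h
  exact ⟨b, a, h2, h1⟩

open Classical in
lemma card_isClose_le {n r m : ℕ} (hr : 1 ≤ r) (i : Fin r → Fin n) :
    (Finset.univ.filter (IsClose m i)).card ≤ 2 * m * r ^ 2 * n ^ (r - 1) := by
  obtain ⟨s, rfl⟩ : ∃ s, r = s + 1 := ⟨r - 1, by omega⟩
  have hsub : Finset.univ.filter (IsClose m i) ⊆
      Finset.univ.biUnion fun a : Fin (s + 1) => Finset.univ.biUnion fun b : Fin (s + 1) =>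
        ((Finset.univ.filter fun t : Fin n => (i a : ℕ) < t + m ∧ (t : ℕ) < i a + m) ×ˢ
          (Finset.univ : Finset (Fin s → Fin n))).image fun z => b.insertNth z.1 z.2 := by
    intro j hj
    obtain ⟨a, b, h1, h2⟩ := (Finset.mem_filter.1 hj).2
    simp only [Finset.mem_biUnion, Finset.mem_univ, true_and, Finset.mem_image, Finset.mem_product]
    exact ⟨a, b, ⟨j b, fun l => j (b.succAbove l)⟩,
      ⟨Finset.mem_filter.2 ⟨Finset.mem_univ _, h1, h2⟩, trivial⟩,
      Fin.insertNth_self_removeNth b j⟩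
  have hwin : ∀ c : ℕ, (Finset.univ.filter fun t : Fin n => c < t + m ∧ (t : ℕ) < c + m).card
      ≤ 2 * m := by
    intro c
    have h : ((Finset.univ.filter fun t : Fin n => c < t + m ∧ (t : ℕ) < c + m).image
        (fun t : Fin n => (t : ℕ))) ⊆ Finset.Ico (c + 1 - m) (c + m) := by
      intro t ht
      obtain ⟨t', ht', rfl⟩ := Finset.mem_image.1 ht
      have := (Finset.mem_filter.1 ht').2
      rw [Finset.mem_Ico]
      omega
    rw [← Finset.card_image_of_injective _ Fin.val_injective]
    refine (Finset.card_le_card h).trans ?_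
    rw [Nat.card_Ico]
    omega
  refine (Finset.card_le_card hsub).trans (Finset.card_biUnion_le.trans ?_)
  refine (Finset.sum_le_card_nsmul _ _ ((s + 1) * (2 * m * n ^ s)) fun v _ => ?_).trans
    (le_of_eq ?_)
  · refine Finset.card_biUnion_le.trans ?_
    refine (Finset.sum_le_card_nsmul _ _ (2 * m * n ^ s) fun u _ => ?_).trans (by simp)
    refine Finset.card_image_le.trans ?_
    rw [Finset.card_product, Finset.card_univ, Fintype.card_fun, Fintype.card_fin, Fintype.card_fin]
    gcongr
    exact hwin _
  · simp
    ring

end Counting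

/-! ### Cumulants of the `V`-statistic -/

section BoundedMeasurable

variable {Ω : Type*} [MeasurableSpace Ω]

/-- The algebra of bounded measurable real functions. -/
def boundedMeasurable (Ω : Type*) [MeasurableSpace Ω] : Subalgebra ℝ (Ω → ℝ) where
  carrier := {g | Measurable g ∧ ∃ C, ∀ ω, |g ω| ≤ C}
  mul_mem' := by
    rintro g h ⟨hg, C, hC⟩ ⟨hh, D, hD⟩
    refine ⟨hg.mul hh, C * D, fun ω => ?_⟩
    rw [Pi.mul_apply, abs_mul]
    exact mul_le_mul (hC ω) (hD ω) (abs_nonneg _) ((abs_nonneg _).trans (hC ω))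
  add_mem' := by
    rintro g h ⟨hg, C, hC⟩ ⟨hh, D, hD⟩
    exact ⟨hg.add hh, C + D, fun ω => (abs_add_le _ _).trans (add_le_add (hC ω) (hD ω))⟩
  algebraMap_mem' c := ⟨measurable_const, |c|, fun _ => le_rfl⟩

lemma integrable_of_boundedMeasurable (μ : Measure Ω) [IsFiniteMeasure μ]
    (g : boundedMeasurable Ω) : Integrable g.1 μ := by
  obtain ⟨hg, C, hC⟩ := g.2
  exact Integrable.of_bound hg.aestronglyMeasurable C (ae_of_all _ hC)

/-- The expectation, as a linear functional on the bounded measurable functions. -/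
noncomputable def boundedExpectation (μ : Measure Ω) [IsFiniteMeasure μ] :
    boundedMeasurable Ω →ₗ[ℝ] ℝ where
  toFun g := ∫ ω, g.1 ω ∂μ
  map_add' g h := integral_add (integrable_of_boundedMeasurable μ g)
    (integrable_of_boundedMeasurable μ h)
  map_smul' c _ := integral_const_mul c _

end BoundedMeasurable

lemma cumulantSeq_const_pow_mul (c : ℝ) (a : ℕ → ℝ) (k : ℕ) :
    cumulantSeq (fun l => c ^ l * a l) k = c ^ k * cumulantSeq a k := by
  induction k using Nat.strong_induction_on with
  | _ k ih =>
  cases k with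
  | zero => simp [cumulantSeq]
  | succ k =>
    rw [cumulantSeq, cumulantSeq, mul_sub, Finset.mul_sum]
    congr 1
    refine Finset.sum_congr rfl fun j _ => ?_
    have hj := j.2
    rw [ih _ (by omega)]
    have : c ^ (k + 1) = c ^ ((j : ℕ) + 1) * c ^ (k - j) := by
      rw [← pow_add]
      congr 1
      omega
    rw [this]
    ring

section PathFunctions

variable {Ω : Type*} [MeasurableSpace Ω] (μ : Measure Ω) [IsProbabilityMeasure μ]
  {X : ℕ → Ω → ℝ}

/-- The joint cumulant of functions of the path at finitely many times is of the order of the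
absolute regularity coefficient when the tuple of functions splits into two parts whose times are
at distance at least `m`. -/
lemma abs_jointCumulant_le_absRegCoeff (hX : ∀ t, Measurable (X t)) {m : ℕ} (hm : 1 ≤ m) {k r : ℕ}
    (g : Fin k → (ℕ → ℝ) → ℝ) (τ : Fin k → Fin r → ℕ) (hg : ∀ i, Measurable (g i))
    (hg1 : ∀ i x, |g i x| ≤ 1) (hgτ : ∀ i, DependsOn (g i) (Set.range (τ i)))
    (p : Fin k → Prop) (hp : ∃ i, p i) (hp' : ∃ i, ¬ p i)
    (hsep : ∀ i j, p i → ¬ p j → ∀ a b, τ i a + m ≤ τ j b ∨ τ j b + m ≤ τ i a) :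
    |jointCumulant (fun T => ∫ ω, ∏ i ∈ T, g i (fun t => X t ω) ∂μ) Finset.univ|
      ≤ 4 ^ (k * k) * (4 * (k * r : ℕ) * absRegCoeff μ X m) := by
  classical
  have hprod : ∀ (T : Finset (Fin k)) x, |∏ i ∈ T, g i x| ≤ 1 := fun T x => by
    rw [Finset.abs_prod]
    exact Finset.prod_le_one (fun i _ => abs_nonneg _) fun i _ => hg1 i x
  have hprodm : ∀ (T : Finset (Fin k)), Measurable fun x => ∏ i ∈ T, g i x := fun T =>
    Finset.measurable_fun_prod T fun i _ => hg i
  have h := abs_jointCumulant_le_of_factorization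
    (fun T => ∫ ω, ∏ i ∈ T, g i (fun t => X t ω) ∂μ) (by simp)
    (fun T => abs_integral_le_one μ fun ω => hprod T _) p
    (ε := 4 * (k * r : ℕ) * absRegCoeff μ X m) Finset.univ ?_ ?_ ?_
  · simpa using h
  · intro T _
    set I : Finset (Fin k) → Finset ℕ := fun U => U.biUnion fun i => Finset.univ.image (τ i)
      with hI
    have hmemI : ∀ U t, t ∈ I U ↔ ∃ i ∈ U, ∃ a, τ i a = t := fun U t => by simp [hI]
    have hIcard : ∀ U, (I U).card ≤ U.card * r := fun U =>
      Finset.card_biUnion_le_card_mul _ _ _ fun i _ => Finset.card_image_le.trans (by simp)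
    have hdep : ∀ U : Finset (Fin k), DependsOn (fun x => ∏ i ∈ U, g i x) (I U : Set ℕ) := by
      intro U x y hxy
      refine Finset.prod_congr rfl fun i hi => hgτ i ?_
      rintro _ ⟨a, rfl⟩
      exact hxy _ ((hmemI U _).2 ⟨i, hi, a, rfl⟩)
    have hcov := abs_covariance_le_absRegCoeff μ hX hm (I (T.filter p))
      (I (T.filter fun i => ¬ p i)) (hprodm (T.filter p)) (hprodm (T.filter fun i => ¬ p i))
      (hprod _) (hprod _) (hdep _) (hdep _) (by
        intro s hs t ht
        obtain ⟨i, hi, a, rfl⟩ := (hmemI _ _).1 hs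
        obtain ⟨j, hj, b, rfl⟩ := (hmemI _ _).1 ht
        exact hsep i j (Finset.mem_filter.1 hi).2 (Finset.mem_filter.1 hj).2 a b)
    simp only [Finset.prod_filter_mul_prod_filter_not] at hcov
    refine hcov.trans ?_
    have hcard : (I (T.filter p)).card + (I (T.filter fun i => ¬ p i)).card ≤ k * r := by
      have h1 := Finset.card_filter_add_card_filter_not (s := T) p
      have h2 : T.card ≤ k := by simpa using Finset.card_le_univ T
      calc _ ≤ (T.filter p).card * r + (T.filter fun i => ¬ p i).card * r :=
            add_le_add (hIcard _) (hIcard _)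
        _ = T.card * r := by rw [← add_mul, h1]
        _ ≤ _ := Nat.mul_le_mul_right r h2
    gcongr
    exact absRegCoeff_nonneg μ m
  · obtain ⟨i, hi⟩ := hp
    exact ⟨i, by simpa using hi⟩
  · obtain ⟨i, hi⟩ := hp'
    exact ⟨i, by simpa using hi⟩

/-- The cumulant bound for a sum of functions `g j`, bounded by one, of the path at the times
`j 0, …, j (r - 1)`: the connected tuples of indices contribute the first summand, the others the
second. -/
lemma abs_cumulantSeq_sum_le (hX : ∀ t, Measurable (X t)) {m : ℕ} (hm : 1 ≤ m) {n r : ℕ}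
    (hr : 1 ≤ r) (g : (Fin r → Fin n) → (ℕ → ℝ) → ℝ) (hg : ∀ j, Measurable (g j))
    (hg1 : ∀ j x, |g j x| ≤ 1) (hgj : ∀ j, DependsOn (g j) (Set.range fun i => (j i : ℕ)))
    (k : ℕ) :
    |cumulantSeq (fun l => ∫ ω, (∑ j, g j (fun t => X t ω)) ^ l ∂μ) (k + 1)|
      ≤ 4 ^ ((k + 1) * (k + 1)) * (((k + 1).factorial : ℝ) ^ 2
          * ((2 * m * r ^ 2 * n ^ (r - 1)) ^ k * n ^ r)
        + 4 * ((k + 1) * r) * absRegCoeff μ X m * (n ^ r) ^ (k + 1)) := by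
  classical
  have hβ := absRegCoeff_nonneg μ (X := X) m
  have hξ : Measurable fun ω t => X t ω := measurable_pi_lambda _ hX
  set W : (Fin r → Fin n) → boundedMeasurable Ω := fun j =>
    ⟨fun ω => g j (fun t => X t ω), (hg j).comp hξ, 1, fun ω => hg1 j _⟩ with hW
  set φ := boundedExpectation μ with hφ
  have hmom : (fun l => ∫ ω, (∑ j, g j (fun t => X t ω)) ^ l ∂μ)
      = fun l => φ ((∑ j, W j) ^ l) := by
    ext l
    simp [hφ, boundedExpectation, hW]
  have hjm : ∀ w : Fin (k + 1) → (Fin r → Fin n), jointMoment φ (fun i => W (w i))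
      = fun T => ∫ ω, ∏ i ∈ T, g (w i) (fun t => X t ω) ∂μ := by
    intro w
    ext T
    simp [jointMoment, hφ, boundedExpectation, hW]
  rw [hmom, cumulantSeq_sum φ W (k + 1) (by omega)]
  set R := IsClose (n := n) (r := r) m with hR
  set K : ℝ := 4 ^ ((k + 1) * (k + 1)) with hK
  set δ : ℝ := 4 * ((k + 1) * r) * absRegCoeff μ X m with hδ
  have hδ0 : 0 ≤ δ := by positivity
  have hterm : ∀ w : Fin (k + 1) → (Fin r → Fin n),
      |jointCumulant (jointMoment φ (fun i => W (w i))) Finset.univ|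
        ≤ (if (tupleGraph R w).Connected then K else 0) + K * δ := by
    intro w
    rw [hjm]
    split_ifs with hc
    · have h := abs_jointCumulant_le (fun T => ∫ ω, ∏ i ∈ T, g (w i) (fun t => X t ω) ∂μ)
        (fun T => abs_integral_le_one μ fun ω => by
          rw [Finset.abs_prod]
          exact Finset.prod_le_one (fun i _ => abs_nonneg _) fun i _ => hg1 _ _) Finset.univ
      rw [Finset.card_univ, Fintype.card_fin] at h
      exact h.trans (le_add_of_nonneg_right (by positivity))
    · obtain ⟨p, hp, hp', hpR⟩ := exists_split_of_not_connected R (by omega) w hc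
      have h := abs_jointCumulant_le_absRegCoeff μ hX hm (fun i => g (w i))
        (fun i a => (w i a : ℕ)) (fun i => hg _) (fun i => hg1 _) (fun i => hgj _) p hp hp' (by
          intro i j hi hj a b
          have := hpR i j hi hj
          simp only [hR, IsClose, not_exists] at this
          have := this a b
          omega)
      rw [zero_add]
      refine h.trans (le_of_eq ?_)
      rw [hK, hδ]
      push_cast
      ring
  refine (Finset.abs_sum_le_sum_abs _ _).trans ((Finset.sum_le_sum fun w _ => hterm w).trans ?_)
  rw [Finset.sum_add_distrib, ← Finset.sum_filter, Finset.sum_const, Finset.sum_const,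
    nsmul_eq_mul, nsmul_eq_mul]
  have hcount := card_connected_le R (fun a b h => h.symm) (2 * m * r ^ 2 * n ^ (r - 1))
    (fun a => card_isClose_le hr a) k
  have hcount' : ((Finset.univ.filter fun w : Fin (k + 1) → (Fin r → Fin n) =>
      (tupleGraph R w).Connected).card : ℝ) ≤ ((k + 1).factorial : ℝ) ^ 2
          * ((2 * m * r ^ 2 * n ^ (r - 1)) ^ k * n ^ r) := by
    rw [Fintype.card_fun, Fintype.card_fin, Fintype.card_fin] at hcount
    exact_mod_cast hcount
  have hall : ((Finset.univ : Finset (Fin (k + 1) → (Fin r → Fin n))).card : ℝ)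
      = (n ^ r) ^ (k + 1) := by
    simp
  rw [hall]
  have : 0 ≤ K := by positivity
  calc _ ≤ ((k + 1).factorial : ℝ) ^ 2 * ((2 * m * r ^ 2 * n ^ (r - 1)) ^ k * n ^ r) * K
        + (n ^ r) ^ (k + 1) * (K * δ) := by gcongr
    _ = _ := by ring

end PathFunctions

lemma abs_vStat_le {Ω : Type*} {X : ℕ → Ω → ℝ} {n r : ℕ}
    {f : (Fin r → Fin n) → (Fin r → ℝ) → ℝ} {F : ℝ} (hF : ∀ j x, |f j x| ≤ F) (ω : Ω) :
    |vStat f X ω| ≤ Fintype.card (Fin r → Fin n) * F := by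
  refine (Finset.abs_sum_le_sum_abs _ _).trans ((Finset.sum_le_sum fun j _ => hF j _).trans ?_)
  simp

section VStat

variable {Ω : Type*} [MeasurableSpace Ω] (μ : Measure Ω) [IsProbabilityMeasure μ]
  {X : ℕ → Ω → ℝ}

lemma measurable_vStat (hX : ∀ t, Measurable (X t)) {n r : ℕ}
    {f : (Fin r → Fin n) → (Fin r → ℝ) → ℝ} (hf : ∀ j, Measurable (f j)) :
    Measurable (vStat f X) :=
  Finset.measurable_fun_sum _ fun j _ => (hf j).comp (measurable_pi_lambda _ fun i => hX (j i))

/-- The standardized `V`-statistic is a multiple of a sum of centred functions of the path that are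
bounded by one. -/
lemma standardized_vStat_eq (hX : ∀ t, Measurable (X t)) {n r : ℕ}
    {f : (Fin r → Fin n) → (Fin r → ℝ) → ℝ} (hf : ∀ j, Measurable (f j)) {F : ℝ} (hF0 : 0 < F)
    (hF : ∀ j x, |f j x| ≤ F) (ω : Ω) :
    standardized μ (vStat f X) ω = 2 * F / √(variance (vStat f X) μ)
      * ∑ j : Fin r → Fin n,
        (f j (fun i => X (j i) ω) - ∫ ω', f j (fun i => X (j i) ω') ∂μ) / (2 * F) := by
  have hint : ∀ j, Integrable (fun ω' => f j (fun i => X (j i) ω')) μ := fun j =>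
    Integrable.of_bound ((hf j).comp (measurable_pi_lambda _ fun i => hX _)).aestronglyMeasurable F
      (ae_of_all _ fun ω => hF j _)
  have hE : ∫ ω', vStat f X ω' ∂μ
      = ∑ j : Fin r → Fin n, ∫ ω', f j (fun i => X (j i) ω') ∂μ := by
    unfold vStat
    exact integral_finsetSum _ fun j _ => hint j
  rw [standardized, hE, ← Finset.sum_div, Finset.sum_sub_distrib]
  simp only [vStat]
  field_simp

lemma abs_cumulantSeq_standardized_le (hX : ∀ t, Measurable (X t)) {m : ℕ} (hm : 1 ≤ m) {n r : ℕ}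
    (hr : 1 ≤ r) {f : (Fin r → Fin n) → (Fin r → ℝ) → ℝ} (hf : ∀ j, Measurable (f j)) {F : ℝ}
    (hF0 : 0 < F) (hF : ∀ j x, |f j x| ≤ F) (k : ℕ) :
    |cumulantSeq (fun l => ∫ ω, standardized μ (vStat f X) ω ^ l ∂μ) (k + 1)|
      ≤ (2 * F / √(variance (vStat f X) μ)) ^ (k + 1) * (4 ^ ((k + 1) * (k + 1))
        * (((k + 1).factorial : ℝ) ^ 2 * ((2 * m * r ^ 2 * n ^ (r - 1)) ^ k * n ^ r)
        + 4 * ((k + 1) * r) * absRegCoeff μ X m * (n ^ r) ^ (k + 1))) := by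
  set c := 2 * F / √(variance (vStat f X) μ) with hc
  have hc0 : 0 ≤ c := by positivity
  set g : (Fin r → Fin n) → (ℕ → ℝ) → ℝ := fun j x =>
    (f j (fun i => x (j i)) - ∫ ω', f j (fun i => X (j i) ω') ∂μ) / (2 * F) with hg
  have hE : ∀ j, |∫ ω', f j (fun i => X (j i) ω') ∂μ| ≤ F := fun j => by
    have h := norm_integral_le_of_norm_le_const (μ := μ)
      (f := fun ω' => f j (fun i => X (j i) ω')) (C := F) (ae_of_all _ fun ω => hF j _)
    simpa using h
  have hseq : (fun l => ∫ ω, standardized μ (vStat f X) ω ^ l ∂μ)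
      = fun l => c ^ l * ∫ ω, (∑ j, g j (fun t => X t ω)) ^ l ∂μ := by
    ext l
    simp_rw [standardized_vStat_eq μ hX hf hF0 hF, mul_pow]
    rw [integral_const_mul]
  rw [hseq, cumulantSeq_const_pow_mul, abs_mul, abs_of_nonneg (pow_nonneg hc0 _)]
  gcongr
  refine abs_cumulantSeq_sum_le μ hX hm hr g (fun j => ?_) (fun j x => ?_) (fun j x y hxy => ?_) k
  · exact (((hf j).comp (measurable_pi_lambda _ fun i => measurable_pi_apply _)).sub_const
      _).div_const _
  · rw [hg, abs_div, abs_of_pos (by positivity : 0 < 2 * F), div_le_one (by positivity)]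
    refine (abs_sub _ _).trans ?_
    linarith [hF j (fun i => x (j i)), hE j]
  · simp only [hg]
    congr 3
    ext i
    exact hxy _ ⟨i, rfl⟩

end VStat

/-- The first summand of the cumulant bound is the `k/2`-th power of the first summand of the
asymptotic condition with `b = 2 / k`. -/
lemma rpow_first_term {F v : ℝ} (hF : 0 < F) (hv : 0 < v) {m n r k : ℕ} (hm : 1 ≤ m) (hn : 1 ≤ n)
    (hr : 1 ≤ r) (hk : 1 ≤ k) :
    (F ^ 2 * (m : ℝ) ^ (2 - 2 / (k : ℝ)) * (n : ℝ) ^ (2 * ((r : ℝ) - 1) + 2 / (k : ℝ))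
      * (r : ℝ) ^ (4 - 2 * (2 / (k : ℝ))) / v) ^ ((k : ℝ) / 2)
      = (F / √v) ^ k * ((m * r ^ 2 * n ^ (r - 1)) ^ (k - 1) * n ^ r) := by
  have hk' : (0 : ℝ) < k := by exact_mod_cast hk
  have hm' : (0 : ℝ) < m := by exact_mod_cast hm
  have hn' : (0 : ℝ) < n := by exact_mod_cast hn
  have hr' : (0 : ℝ) < r := by exact_mod_cast hr
  obtain ⟨s, rfl⟩ : ∃ s, r = s + 1 := ⟨r - 1, by omega⟩
  obtain ⟨l, rfl⟩ : ∃ l, k = l + 1 := ⟨k - 1, by omega⟩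
  have hpow : ∀ (x : ℝ), 0 < x → ∀ (e : ℝ) (N : ℕ), e * (((l + 1 : ℕ) : ℝ) / 2) = N →
      (x ^ e) ^ (((l + 1 : ℕ) : ℝ) / 2) = x ^ N := fun x hx e N h => by
    rw [← Real.rpow_mul hx.le, h, Real.rpow_natCast]
  have e1 : (F ^ 2) ^ (((l + 1 : ℕ) : ℝ) / 2) = F ^ (l + 1) := by
    rw [← Real.rpow_natCast F 2]
    exact hpow F hF _ _ (by push_cast; ring)
  have e2 : v ^ (((l + 1 : ℕ) : ℝ) / 2) = √v ^ (l + 1) := by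
    rw [Real.sqrt_eq_rpow, ← Real.rpow_natCast, ← Real.rpow_mul hv.le]
    congr 1
    ring
  rw [Real.div_rpow (by positivity) hv.le, Real.mul_rpow (by positivity) (by positivity),
    Real.mul_rpow (by positivity) (by positivity), Real.mul_rpow (by positivity) (by positivity),
    e1, e2, hpow (m : ℝ) hm' _ l (by push_cast at hk' ⊢; field_simp; ring),
    hpow (n : ℝ) hn' _ (s * l + (s + 1)) ?_,
    hpow ((s + 1 : ℕ) : ℝ) hr' _ (2 * l) (by push_cast at hk' ⊢; field_simp; ring)]
  · simp only [Nat.add_sub_cancel]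
    rw [div_pow, mul_pow, mul_pow, ← pow_mul, ← pow_mul, pow_add]
    ring
  · push_cast at hk' ⊢
    field_simp
    ring

/-- The second summand of the cumulant bound is the `k/2`-th power of the second summand of the
asymptotic condition with `b = 2 / k`. -/
lemma rpow_second_term {F v β : ℝ} (hF : 0 < F) (hv : 0 < v) (hβ : 0 ≤ β) {n r k : ℕ}
    (hk : 1 ≤ k) :
    (β ^ (2 / (k : ℝ)) * (F ^ 2 * (n : ℝ) ^ (2 * r) / v)) ^ ((k : ℝ) / 2)
      = (F / √v) ^ k * (β * (n ^ r) ^ k) := by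
  have hk' : (0 : ℝ) < k := by exact_mod_cast hk
  have e1 : (β ^ (2 / (k : ℝ))) ^ ((k : ℝ) / 2) = β := by
    rw [← Real.rpow_mul hβ]
    have : 2 / (k : ℝ) * (k / 2) = 1 := by field_simp
    rw [this, Real.rpow_one]
  have e2 : F ^ 2 * (n : ℝ) ^ (2 * r) / v = (F / √v * n ^ r) ^ (2 : ℝ) := by
    rw [Real.rpow_two, mul_pow, div_pow, Real.sq_sqrt hv.le]
    ring
  have e3 : (2 : ℝ) * ((k : ℝ) / 2) = k := by ring
  rw [Real.mul_rpow (by positivity) (by positivity), e1, e2, ← Real.rpow_mul (by positivity), e3,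
    Real.rpow_natCast, mul_pow]
  ring

/-- Under the asymptotic condition the high-order cumulants of the standardized `V`-statistics
vanish in the limit. -/
lemma tendsto_cumulantSeq_standardized
    {Ω : ℕ → Type*} [∀ n, MeasurableSpace (Ω n)]
    (P : ∀ n, Measure (Ω n)) [∀ n, IsProbabilityMeasure (P n)]
    (X : ∀ n, ℕ → Ω n → ℝ) (hX : ∀ n t, Measurable (X n t)) (r : ℕ) (hr : 1 ≤ r)
    (f : ∀ n, (Fin r → Fin n) → (Fin r → ℝ) → ℝ) (hf : ∀ n j, Measurable (f n j))
    (F : ℕ → ℝ) (hF : ∀ n j x, |f n j x| ≤ F n) (m : ℕ → ℕ) (hm : ∀ n, 1 ≤ m n)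
    (hvar : ∀ᶠ n in atTop, 0 < variance (vStat (f n) (X n)) (P n)) (hF0 : ∀ᶠ n in atTop, 0 < F n)
    (k : ℕ) (hk : 1 ≤ k)
    (hcond : Tendsto (fun n : ℕ =>
        F n ^ 2 * (m n : ℝ) ^ (2 - 2 / (k : ℝ)) * (n : ℝ) ^ (2 * ((r : ℝ) - 1) + 2 / (k : ℝ))
          * (r : ℝ) ^ (4 - 2 * (2 / (k : ℝ))) / variance (vStat (f n) (X n)) (P n)
          + absRegCoeff (P n) (X n) (m n) ^ (2 / (k : ℝ))
            * (F n ^ 2 * (n : ℝ) ^ (2 * r) / variance (vStat (f n) (X n)) (P n)))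
        atTop (𝓝 0)) :
    Tendsto (fun n => cumulantSeq
      (fun l => ∫ ω, standardized (P n) (vStat (f n) (X n)) ω ^ l ∂(P n)) k) atTop (𝓝 0) := by
  have hk' : (0 : ℝ) < k := by exact_mod_cast hk
  set q : ℕ → ℝ := fun n : ℕ =>
        F n ^ 2 * (m n : ℝ) ^ (2 - 2 / (k : ℝ)) * (n : ℝ) ^ (2 * ((r : ℝ) - 1) + 2 / (k : ℝ))
          * (r : ℝ) ^ (4 - 2 * (2 / (k : ℝ))) / variance (vStat (f n) (X n)) (P n)
          + absRegCoeff (P n) (X n) (m n) ^ (2 / (k : ℝ))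
            * (F n ^ 2 * (n : ℝ) ^ (2 * r) / variance (vStat (f n) (X n)) (P n)) with hq
  set C1 : ℝ := 2 ^ k * 4 ^ (k * k) * ((k.factorial : ℝ) ^ 2 * 2 ^ (k - 1)) with hC1
  set C2 : ℝ := 2 ^ k * 4 ^ (k * k) * (4 * (k * r)) with hC2
  have hlim : Tendsto (fun n => (C1 + C2) * q n ^ ((k : ℝ) / 2)) atTop (𝓝 0) := by
    have h := (hcond.rpow_const (p := (k : ℝ) / 2) (Or.inr (by positivity))).const_mul (C1 + C2)
    rwa [Real.zero_rpow (by positivity), mul_zero] at h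
  refine squeeze_zero_norm' ?_ hlim
  filter_upwards [hvar, hF0, eventually_ge_atTop 1] with n hv hFn hn
  have hβ := absRegCoeff_nonneg (P n) (X := X n) (m n)
  have hb := abs_cumulantSeq_standardized_le (P n) (hX n) (hm n) hr (hf n) hFn (hF n) (k - 1)
  obtain ⟨l, rfl⟩ : ∃ l, k = l + 1 := ⟨k - 1, by omega⟩
  have h1 := rpow_first_term hFn hv (hm n) hn hr hk
  have h2 := rpow_second_term hFn hv hβ (n := n) (r := r) hk
  simp only [Nat.add_sub_cancel] at hb h1 h2 hC1
  rw [Real.norm_eq_abs]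
  refine hb.trans ?_
  set v := variance (vStat (f n) (X n)) (P n) with hvdef
  set β := absRegCoeff (P n) (X n) (m n) with hβdef
  have hA : 0 ≤ F n ^ 2 * (m n : ℝ) ^ (2 - 2 / ((l + 1 : ℕ) : ℝ))
      * (n : ℝ) ^ (2 * ((r : ℝ) - 1) + 2 / ((l + 1 : ℕ) : ℝ))
      * (r : ℝ) ^ (4 - 2 * (2 / ((l + 1 : ℕ) : ℝ))) / v := by positivity
  have hB : 0 ≤ β ^ (2 / ((l + 1 : ℕ) : ℝ)) * (F n ^ 2 * (n : ℝ) ^ (2 * r) / v) := by positivity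
  have h1' : (F n / √v) ^ (l + 1) * ((m n * r ^ 2 * n ^ (r - 1)) ^ l * n ^ r)
      ≤ q n ^ (((l + 1 : ℕ) : ℝ) / 2) := by
    rw [← h1]
    exact Real.rpow_le_rpow hA (le_add_of_nonneg_right hB) (by positivity)
  have h2' : (F n / √v) ^ (l + 1) * (β * (n ^ r) ^ (l + 1)) ≤ q n ^ (((l + 1 : ℕ) : ℝ) / 2) := by
    rw [← h2]
    exact Real.rpow_le_rpow hB (le_add_of_nonneg_left hA) (by positivity)
  calc _ = C1 * ((F n / √v) ^ (l + 1) * ((m n * r ^ 2 * n ^ (r - 1)) ^ l * n ^ r))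
        + C2 * ((F n / √v) ^ (l + 1) * (β * (n ^ r) ^ (l + 1))) := by
          rw [hC1, hC2, mul_div_assoc, mul_pow 2 (F n / √v)]
          have : (2 * (m n : ℝ) * r ^ 2 * n ^ (r - 1)) ^ l
              = 2 ^ l * (m n * r ^ 2 * n ^ (r - 1)) ^ l := by
            rw [← mul_pow]
            ring
          rw [this]
          push_cast
          ring
    _ ≤ C1 * q n ^ (((l + 1 : ℕ) : ℝ) / 2) + C2 * q n ^ (((l + 1 : ℕ) : ℝ) / 2) := by
          gcongr
    _ = _ := by ring

/-! ### Moments as Taylor coefficients -/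

/-- The moment sequence with the cumulants `α 1, α 2, …`; it inverts `cumulantSeq`. -/
noncomputable def momentSeq (α : ℕ → ℝ) : ℕ → ℝ
  | 0 => 1
  | k + 1 => ∑ j : Fin (k + 1), (k.choose j : ℝ) * α (j + 1) * momentSeq α (k - j)

lemma momentSeq_succ (α : ℕ → ℝ) (k : ℕ) :
    momentSeq α (k + 1) = ∑ j ∈ Finset.range (k + 1),
      (k.choose j : ℝ) * α (j + 1) * momentSeq α (k - j) := by
  rw [momentSeq, Finset.sum_range (n := k + 1)]

/-- Convergence of the cumulants implies convergence of the moments. -/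
lemma tendsto_momentSeq {ι : Type*} {l : Filter ι} (M : ι → ℕ → ℝ) (hM : ∀ n, M n 0 = 1)
    (α : ℕ → ℝ) (h : ∀ j, 1 ≤ j → Tendsto (fun n => cumulantSeq (M n) j) l (𝓝 (α j))) (k : ℕ) :
    Tendsto (fun n => M n k) l (𝓝 (momentSeq α k)) := by
  induction k using Nat.strong_induction_on with
  | _ k ih =>
  cases k with
  | zero => simpa [hM, momentSeq] using tendsto_const_nhds
  | succ k =>
    rw [momentSeq_succ]
    refine Tendsto.congr (fun n => (moment_succ_eq_sum_cumulantSeq (M n) (hM n) k).symm) ?_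
    exact tendsto_finsetSum _ fun j _ => ((h (j + 1) (by omega)).const_mul _).mul
      (ih (k - j) (by omega))

/-- If `f' = h f` and `f 0 = 1`, so that `f` is the exponential of a primitive of `h`, then the
derivatives of `f` at the origin are the moments whose cumulants are the derivatives of `h`. -/
lemma iteratedDeriv_zero_eq_momentSeq {𝕜 : Type*} [RCLike 𝕜] {f h : 𝕜 → 𝕜}
    (hf : ∀ n : ℕ, ContDiff 𝕜 n f) (hh : ∀ n : ℕ, ContDiff 𝕜 n h) (hf0 : f 0 = 1)
    (hfh : deriv f = h * f) (α : ℕ → ℝ) (hα : ∀ j, iteratedDeriv j h 0 = (α (j + 1) : 𝕜)) (k : ℕ) :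
    iteratedDeriv k f 0 = (momentSeq α k : 𝕜) := by
  induction k using Nat.strong_induction_on with
  | _ k ih =>
  cases k with
  | zero => simp [hf0, momentSeq]
  | succ k =>
    rw [iteratedDeriv_succ', hfh, iteratedDeriv_mul (hh k).contDiffAt (hf k).contDiffAt,
      momentSeq_succ]
    push_cast
    refine Finset.sum_congr rfl fun j _ => ?_
    rw [hα, ih (k - j) (by omega)]

/-- The cumulant generating polynomial `∑_{1 ≤ k ≤ e} α k z ^ k / k!`. -/
noncomputable def cumulantPoly (α : ℕ → ℝ) (e : ℕ) (z : ℂ) : ℂ :=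
  ∑ j ∈ Finset.range e, (α (j + 1) : ℂ) * z ^ (j + 1) / (j + 1).factorial

lemma hasDerivAt_cumulantPoly (α : ℕ → ℝ) (e : ℕ) (z : ℂ) :
    HasDerivAt (cumulantPoly α e)
      (∑ j ∈ Finset.range e, (α (j + 1) / j.factorial : ℂ) * z ^ j) z := by
  unfold cumulantPoly
  refine HasDerivAt.fun_sum fun j _ => ?_
  have h := ((hasDerivAt_pow (j + 1) z).const_mul (α (j + 1) : ℂ)).div_const
    ((j + 1).factorial : ℂ)
  refine h.congr_deriv ?_
  have h1 : (j.factorial : ℂ) ≠ 0 := by exact_mod_cast j.factorial_ne_zero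
  have h2 : ((j : ℂ) + 1) ≠ 0 := by exact_mod_cast j.succ_ne_zero
  rw [Nat.factorial_succ]
  push_cast
  field_simp

lemma hasSum_momentSeq (α : ℕ → ℝ) (e : ℕ) (hα : ∀ k, e < k → α k = 0) (z : ℂ) :
    HasSum (fun k : ℕ => (momentSeq α k : ℂ) * (z ^ k / k.factorial))
      (Complex.exp (cumulantPoly α e z)) := by
  set h : ℂ → ℂ := fun z => ∑ j ∈ Finset.range e, (α (j + 1) / j.factorial : ℂ) * z ^ j with hh
  set f : ℂ → ℂ := fun z => Complex.exp (cumulantPoly α e z) with hf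
  have hd : ∀ z, HasDerivAt f (Complex.exp (cumulantPoly α e z) * h z) z := fun z =>
    (hasDerivAt_cumulantPoly α e z).cexp
  have hfd : Differentiable ℂ f := fun z => (hd z).differentiableAt
  have hhs : ∀ n : ℕ, ContDiff ℂ n h := fun n => by
    rw [hh]
    fun_prop
  have hit : ∀ k, iteratedDeriv k f 0 = (momentSeq α k : ℂ) := by
    refine iteratedDeriv_zero_eq_momentSeq (fun n => hfd.contDiff) hhs ?_ ?_ α ?_
    · simp [hf, cumulantPoly]
    · ext z
      rw [(hd z).deriv, Pi.mul_apply, mul_comm]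
    · intro j
      have hone : ∀ i : ℕ, iteratedDeriv j (fun z : ℂ => (α (i + 1) / i.factorial : ℂ) * z ^ i) 0
          = (α (i + 1) / i.factorial : ℂ) * if j = i then i.factorial else 0 := fun i => by
        rw [iteratedDeriv_const_mul_field, iteratedDeriv_fun_pow_zero]
      rw [hh, iteratedDeriv_fun_sum fun i _ => by fun_prop]
      simp only [hone, Nat.cast_ite, Nat.cast_zero, mul_ite, mul_zero,
        Finset.sum_ite_eq, Finset.mem_range]
      have h1 : (j.factorial : ℂ) ≠ 0 := by exact_mod_cast j.factorial_ne_zero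
      split_ifs with hj
      · rw [div_mul_cancel₀ _ h1]
        rfl
      · rw [hα (j + 1) (by omega)]
        simp
  have key := Complex.hasSum_taylorSeries_of_entire hfd 0 z
  refine key.congr_fun ?_
  intro k
  rw [hit, sub_zero, smul_eq_mul, smul_eq_mul]
  ring

lemma sum_antidiagonal_pow_div_factorial {K : Type*} [Field K] [CharZero K] (x y : K) (k : ℕ) :
    ∑ p ∈ Finset.HasAntidiagonal.antidiagonal k, x ^ p.1 / p.1.factorial * (y ^ p.2 / p.2.factorial)
      = (x + y) ^ k / k.factorial := by
  have := (Commute.all x y).add_pow' k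
  rw [this, Finset.sum_div]
  refine Finset.sum_congr rfl fun p hp => ?_
  rw [← Finset.HasAntidiagonal.mem_antidiagonal.1 hp, nsmul_eq_mul, Nat.cast_add_choose]
  have h1 : (p.1.factorial : K) ≠ 0 := by exact_mod_cast p.1.factorial_ne_zero
  have h2 : (p.2.factorial : K) ≠ 0 := by exact_mod_cast p.2.factorial_ne_zero
  have h3 : ((p.1 + p.2).factorial : K) ≠ 0 := by exact_mod_cast (p.1 + p.2).factorial_ne_zero
  field_simp

/-- The exponential series in two variables, applied termwise to a moment functional. -/
lemma hasSum_momentSeq_add (α : ℕ → ℝ) (e : ℕ) (hα : ∀ k, e < k → α k = 0) (x y : ℂ) :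
    HasSum (fun p : ℕ × ℕ => (momentSeq α (p.1 + p.2) : ℂ)
      * (x ^ p.1 / p.1.factorial * (y ^ p.2 / p.2.factorial)))
      (Complex.exp (cumulantPoly α e (x + y))) := by
  set F : ℕ × ℕ → ℂ := fun p => (momentSeq α (p.1 + p.2) : ℂ)
      * (x ^ p.1 / p.1.factorial * (y ^ p.2 / p.2.factorial)) with hF
  have hsummable : Summable F := by
    rw [← summable_norm_iff, ← Finset.HasAntidiagonal.sigmaAntidiagonalEquivProd.summable_iff]
    refine (summable_sigma_of_nonneg fun _ => norm_nonneg _).2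
      ⟨fun k => (hasSum_fintype _).summable, ?_⟩
    have h1 := (hasSum_momentSeq α e hα ((‖x‖ + ‖y‖ : ℝ) : ℂ)).summable.norm
    refine h1.congr fun k => ?_
    rw [tsum_fintype]
    have e1 : ∀ p : Finset.HasAntidiagonal.antidiagonal k,
        ‖F (Finset.HasAntidiagonal.sigmaAntidiagonalEquivProd ⟨k, p⟩)‖
          = |momentSeq α k| * (‖x‖ ^ p.1.1 / p.1.1.factorial
            * (‖y‖ ^ p.1.2 / p.1.2.factorial)) := by
      rintro ⟨p, hp⟩
      rw [Finset.HasAntidiagonal.sigmaAntidiagonalEquivProd_apply]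
      simp only [hF]
      rw [Finset.HasAntidiagonal.mem_antidiagonal.1 hp]
      simp
    rw [Finset.sum_congr rfl fun p _ => e1 p,
      Finset.sum_coe_sort (Finset.HasAntidiagonal.antidiagonal k)
      (fun p : ℕ × ℕ => |momentSeq α k| *
      (‖x‖ ^ p.1 / p.1.factorial * (‖y‖ ^ p.2 / p.2.factorial))), ← Finset.mul_sum,
      sum_antidiagonal_pow_div_factorial]
    have h0 : 0 ≤ ‖x‖ + ‖y‖ := by positivity
    rw [norm_mul, norm_div, norm_pow, Complex.norm_real, Complex.norm_real, Real.norm_eq_abs,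
      Real.norm_eq_abs, abs_of_nonneg h0]
    simp
  have h2 := (Finset.HasAntidiagonal.sigmaAntidiagonalEquivProd.hasSum_iff).2 hsummable.hasSum
  have h3 := h2.sigma fun k => hasSum_fintype _
  have h4 := hasSum_momentSeq α e hα (x + y)
  have h5 : (fun k : ℕ => ∑ p : Finset.HasAntidiagonal.antidiagonal k,
      (F ∘ Finset.HasAntidiagonal.sigmaAntidiagonalEquivProd) ⟨k, p⟩)
      = fun k : ℕ => (momentSeq α k : ℂ) * ((x + y) ^ k / k.factorial) := by
    ext k
    have e1 : ∀ p : Finset.HasAntidiagonal.antidiagonal k,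
        (F ∘ Finset.HasAntidiagonal.sigmaAntidiagonalEquivProd) ⟨k, p⟩
          = (momentSeq α k : ℂ) * (x ^ p.1.1 / p.1.1.factorial
            * (y ^ p.1.2 / p.1.2.factorial)) := by
      rintro ⟨p, hp⟩
      rw [Function.comp_apply, Finset.HasAntidiagonal.sigmaAntidiagonalEquivProd_apply]
      simp only [hF]
      rw [Finset.HasAntidiagonal.mem_antidiagonal.1 hp]
    simp only [e1]
    rw [Finset.sum_coe_sort (Finset.HasAntidiagonal.antidiagonal k)
      (fun p : ℕ × ℕ => (momentSeq α k : ℂ) *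
      (x ^ p.1 / p.1.factorial * (y ^ p.2 / p.2.factorial))), ← Finset.mul_sum,
      sum_antidiagonal_pow_div_factorial]
  rw [h5] at h3
  rw [h4.unique h3]
  exact hsummable.hasSum

lemma tendsto_sum_momentSeq (α : ℕ → ℝ) (e : ℕ) (hα : ∀ k, e < k → α k = 0) (x y : ℂ) :
    Tendsto (fun N => ∑ i ∈ Finset.range N, ∑ j ∈ Finset.range N, (momentSeq α (i + j) : ℂ)
      * (x ^ i / i.factorial * (y ^ j / j.factorial)))
      atTop (𝓝 (Complex.exp (cumulantPoly α e (x + y)))) := by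
  have h : Tendsto (fun N => Finset.range N ×ˢ Finset.range N) atTop
      (atTop : Filter (Finset (ℕ × ℕ))) := by
    refine tendsto_atTop_finset_of_monotone ?_ ?_
    · intro a b hab
      exact Finset.product_subset_product (Finset.range_mono hab) (Finset.range_mono hab)
    · rintro ⟨a, b⟩
      refine ⟨max a b + 1, ?_⟩
      simp only [Finset.mem_product, Finset.mem_range]
      omega
  have h2 : Tendsto (fun s : Finset (ℕ × ℕ) => ∑ p ∈ s, (momentSeq α (p.1 + p.2) : ℂ)
      * (x ^ p.1 / p.1.factorial * (y ^ p.2 / p.2.factorial))) atTop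
      (𝓝 (Complex.exp (cumulantPoly α e (x + y)))) := hasSum_momentSeq_add α e hα x y
  refine (h2.comp h).congr fun N => ?_
  rw [Function.comp_apply, Finset.sum_product]

/-! ### Marcinkiewicz's theorem for moment sequences -/

/-- The property of a moment sequence `M k = E Y ^ k` that `|E p(Y) ^ 2| ≤ E |p(Y)| ^ 2` for all
complex polynomials `p = ∑ c i Y ^ i`. -/
def IsMomentLike (M : ℕ → ℝ) : Prop :=
  ∀ (N : ℕ) (c : ℕ → ℂ),
    ‖∑ i ∈ Finset.range N, ∑ j ∈ Finset.range N, (M (i + j) : ℂ) * (c i * c j)‖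
      ≤ (∑ i ∈ Finset.range N, ∑ j ∈ Finset.range N,
        (M (i + j) : ℂ) * (c i * starRingEnd ℂ (c j))).re

lemma isMomentLike_integral {Ω : Type*} [MeasurableSpace Ω] (μ : Measure Ω) [IsFiniteMeasure μ]
    {Y : Ω → ℝ} (hY : Measurable Y) {C : ℝ} (hC : ∀ ω, |Y ω| ≤ C) :
    IsMomentLike fun k => ∫ ω, Y ω ^ k ∂μ := by
  intro N c
  have hint : ∀ k : ℕ, Integrable (fun ω => ((Y ω ^ k : ℝ) : ℂ)) μ := fun k =>
    (Integrable.of_bound (hY.pow_const k).aestronglyMeasurable (C ^ k)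
      (ae_of_all _ fun ω => by
        rw [norm_pow]
        exact pow_le_pow_left₀ (norm_nonneg _) (hC ω) k)).ofReal
  set p : Ω → ℂ := fun ω => ∑ i ∈ Finset.range N, c i * (Y ω : ℂ) ^ i with hp
  have hexp : ∀ d : ℕ → ℂ, ∑ i ∈ Finset.range N, ∑ j ∈ Finset.range N,
      ((∫ ω, Y ω ^ (i + j) ∂μ : ℝ) : ℂ) * (c i * d j)
      = ∫ ω, p ω * ∑ j ∈ Finset.range N, d j * (Y ω : ℂ) ^ j ∂μ := by
    intro d
    have e : ∀ ω, p ω * ∑ j ∈ Finset.range N, d j * (Y ω : ℂ) ^ j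
        = ∑ i ∈ Finset.range N, ∑ j ∈ Finset.range N,
          ((Y ω ^ (i + j) : ℝ) : ℂ) * (c i * d j) := fun ω => by
      rw [hp, Finset.sum_mul_sum]
      refine Finset.sum_congr rfl fun i _ => Finset.sum_congr rfl fun j _ => ?_
      push_cast
      ring
    simp_rw [e]
    rw [integral_finsetSum _ fun i _ => integrable_finsetSum _ fun j _ => (hint _).mul_const _]
    refine Finset.sum_congr rfl fun i _ => ?_
    rw [integral_finsetSum _ fun j _ => (hint _).mul_const _]
    refine Finset.sum_congr rfl fun j _ => ?_
    rw [integral_mul_const]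
    exact congrArg (· * (c i * d j)) integral_ofReal.symm
  rw [hexp c, hexp fun j => starRingEnd ℂ (c j)]
  have e2 : ∀ ω, p ω * ∑ j ∈ Finset.range N, starRingEnd ℂ (c j) * (Y ω : ℂ) ^ j
      = ((‖p ω‖ ^ 2 : ℝ) : ℂ) := fun ω => by
    have : ∑ j ∈ Finset.range N, starRingEnd ℂ (c j) * (Y ω : ℂ) ^ j = starRingEnd ℂ (p ω) := by
      rw [hp, map_sum]
      refine Finset.sum_congr rfl fun j _ => ?_
      rw [map_mul, map_pow, Complex.conj_ofReal]
    rw [this, Complex.mul_conj, Complex.normSq_eq_norm_sq]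
  have e3 : ∀ ω, ‖p ω * ∑ j ∈ Finset.range N, c j * (Y ω : ℂ) ^ j‖ = ‖p ω‖ ^ 2 := fun ω => by
    rw [norm_mul, sq]
  simp_rw [e2]
  have e4 : ∫ ω, ((‖p ω‖ ^ 2 : ℝ) : ℂ) ∂μ = ((∫ ω, ‖p ω‖ ^ 2 ∂μ : ℝ) : ℂ) := integral_ofReal
  rw [e4, Complex.ofReal_re]
  refine (norm_integral_le_integral_norm _).trans (le_of_eq ?_)
  simp_rw [e3]

lemma IsMomentLike.pow_mul {M : ℕ → ℝ} (hM : IsMomentLike M) (s : ℝ) :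
    IsMomentLike fun k => s ^ k * M k := by
  intro N c
  have h := hM N fun i => (s : ℂ) ^ i * c i
  have e : ∀ i j : ℕ, ∀ a b : ℂ, ((s ^ (i + j) * M (i + j) : ℝ) : ℂ) * (a * b)
      = (M (i + j) : ℂ) * ((s : ℂ) ^ i * a * ((s : ℂ) ^ j * b)) := fun i j a b => by
    push_cast
    ring
  simp only [e]
  simpa only [map_mul, map_pow, Complex.conj_ofReal] using h

lemma IsMomentLike.of_tendsto {ι : Type*} {l : Filter ι} [l.NeBot] {M : ι → ℕ → ℝ} {M' : ℕ → ℝ}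
    (hM : ∀ᶠ n in l, IsMomentLike (M n)) (h : ∀ k, Tendsto (fun n => M n k) l (𝓝 (M' k))) :
    IsMomentLike M' := by
  intro N c
  have h' : ∀ k, Tendsto (fun n => (M n k : ℂ)) l (𝓝 (M' k : ℂ)) := fun k =>
    (Complex.continuous_ofReal.tendsto _).comp (h k)
  have hs : ∀ d : ℕ → ℂ, Tendsto (fun n => ∑ i ∈ Finset.range N, ∑ j ∈ Finset.range N,
      (M n (i + j) : ℂ) * (c i * d j)) l (𝓝 (∑ i ∈ Finset.range N, ∑ j ∈ Finset.range N,
      (M' (i + j) : ℂ) * (c i * d j))) := fun d =>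
    tendsto_finsetSum _ fun i _ => tendsto_finsetSum _ fun j _ => (h' _).mul_const _
  exact le_of_tendsto_of_tendsto (hs c).norm
    ((Complex.continuous_re.tendsto _).comp (hs fun j => starRingEnd ℂ (c j)))
    (hM.mono fun n hn => hn N c)

lemma cumulantPoly_ofReal (α : ℕ → ℝ) (e : ℕ) (x : ℝ) :
    cumulantPoly α e x
      = ((∑ j ∈ Finset.range e, α (j + 1) * x ^ (j + 1) / (j + 1).factorial : ℝ) : ℂ) := by
  unfold cumulantPoly
  push_cast
  rfl

/-- The limiting form of `|E exp (z Y)| ≤ E exp (re z Y)`: the real part of the cumulant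
generating function is largest, on a vertical line, at the real point. -/
lemma re_cumulantPoly_le (α : ℕ → ℝ) (e : ℕ) (hα : ∀ k, e < k → α k = 0)
    (hpos : IsMomentLike (momentSeq α)) (z : ℂ) :
    (cumulantPoly α e z).re ≤ (cumulantPoly α e (z.re : ℂ)).re := by
  have h1 := (tendsto_sum_momentSeq α e hα (z / 2) (z / 2)).norm
  have h2 := (Complex.continuous_re.tendsto _).comp
    (tendsto_sum_momentSeq α e hα (z / 2) (starRingEnd ℂ (z / 2)))
  have e1 : z / 2 + z / 2 = z := by ring
  have e2 : z / 2 + starRingEnd ℂ (z / 2) = (z.re : ℂ) := by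
    rw [Complex.add_conj]
    simp
    ring
  rw [e1] at h1
  rw [e2] at h2
  have hle := le_of_tendsto_of_tendsto h1 h2 (Eventually.of_forall fun N => by
    have := hpos N fun i => (z / 2) ^ i / i.factorial
    simpa only [map_div₀, map_pow, map_natCast, Complex.conj_ofReal,
      Function.comp_apply] using this)
  rw [Complex.norm_exp, cumulantPoly_ofReal, ← Complex.ofReal_exp, Complex.ofReal_re,
    Real.exp_le_exp] at hle
  rw [cumulantPoly_ofReal, Complex.ofReal_re]
  exact hle

/-- Comparison of the leading coefficients in `re_cumulantPoly_le` along a ray. -/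
lemma leading_cumulant_mul_le (α : ℕ → ℝ) (e : ℕ) (he : 1 ≤ e)
    (h : ∀ z : ℂ, (cumulantPoly α e z).re ≤ (cumulantPoly α e (z.re : ℂ)).re) (θ : ℝ) :
    α e * (Real.cos (e * θ) - Real.cos θ ^ e) ≤ 0 := by
  obtain ⟨d, rfl⟩ : ∃ d, e = d + 1 := ⟨e - 1, by omega⟩
  set c : ℕ → ℝ := fun j =>
    α (j + 1) / (j + 1).factorial * (Real.cos ((j + 1 : ℕ) * θ) - Real.cos θ ^ (j + 1)) with hc
  have hray : ∀ t : ℝ, ∑ j ∈ Finset.range (d + 1), c j * t ^ (j + 1) ≤ 0 := by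
    intro t
    have h1 := h ((t : ℂ) * Complex.exp (θ * Complex.I))
    have hre : ((t : ℂ) * Complex.exp (θ * Complex.I)).re = t * Real.cos θ := by
      rw [Complex.re_ofReal_mul, Complex.exp_ofReal_mul_I_re]
    rw [hre, cumulantPoly_ofReal, Complex.ofReal_re, cumulantPoly, Complex.re_sum] at h1
    have e1 : ∀ j : ℕ, ((α (j + 1) : ℂ) * ((t : ℂ) * Complex.exp (θ * Complex.I)) ^ (j + 1)
        / (j + 1).factorial).re
        = α (j + 1) / (j + 1).factorial * Real.cos ((j + 1 : ℕ) * θ) * t ^ (j + 1) := by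
      intro j
      have : (α (j + 1) : ℂ) * ((t : ℂ) * Complex.exp (θ * Complex.I)) ^ (j + 1)
          / (j + 1).factorial = ((α (j + 1) * t ^ (j + 1) / (j + 1).factorial : ℝ) : ℂ)
            * Complex.exp (((j + 1 : ℕ) * θ : ℝ) * Complex.I) := by
        rw [mul_pow, ← Complex.exp_nat_mul]
        push_cast
        rw [← mul_assoc ((j : ℂ) + 1)]
        ring
      rw [this, Complex.re_ofReal_mul, Complex.exp_ofReal_mul_I_re]
      ring
    rw [Finset.sum_congr rfl fun j _ => e1 j, ← sub_nonpos, ← Finset.sum_sub_distrib] at h1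
    refine le_trans (le_of_eq (Finset.sum_congr rfl fun j _ => ?_)) h1
    rw [hc, mul_pow]
    ring
  -- In the variable `s = 1 / t` the limit `t → ∞` becomes continuity at `0`.
  have hinv : ∀ s : ℝ, 0 < s → ∑ j ∈ Finset.range (d + 1), c j * s ^ (d - j) ≤ 0 := by
    intro s hs
    have h1 := mul_nonpos_of_nonneg_of_nonpos (pow_nonneg hs.le (d + 1)) (hray s⁻¹)
    rw [Finset.mul_sum] at h1
    refine le_trans (le_of_eq (Finset.sum_congr rfl fun j hj => ?_)) h1
    have hj' : d + 1 = (d - j) + (j + 1) := by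
      have := Finset.mem_range.1 hj
      omega
    rw [hj', pow_add, inv_pow]
    field_simp
  have hcont : Tendsto (fun s : ℝ => ∑ j ∈ Finset.range (d + 1), c j * s ^ (d - j)) (𝓝[>] 0)
      (𝓝 (∑ j ∈ Finset.range (d + 1), c j * 0 ^ (d - j))) :=
    (Continuous.tendsto (by fun_prop) 0).mono_left nhdsWithin_le_nhds
  have hlim := le_of_tendsto hcont (eventually_mem_nhdsWithin.mono fun s hs => hinv s hs)
  rw [Finset.sum_range_succ, Finset.sum_eq_zero fun j hj => by
    have := Finset.mem_range.1 hj
    rw [zero_pow (by omega), mul_zero]] at hlim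
  simp only [Nat.sub_self, pow_zero, mul_one, zero_add, hc] at hlim
  have hf : (0 : ℝ) < (d + 1).factorial := by exact_mod_cast (d + 1).factorial_pos
  rw [div_mul_eq_mul_div, div_le_iff₀ hf, zero_mul] at hlim
  exact hlim

/-- A leading coefficient of degree at least three contradicts the inequality on the ray at angle
`2 π / e`, if it is positive, or at angle `π / e`, if it is negative. -/
lemma leading_cumulant_eq_zero (α : ℕ → ℝ) (e : ℕ) (he : 3 ≤ e) (hα : ∀ k, e < k → α k = 0)
    (hpos : IsMomentLike (momentSeq α)) : α e = 0 := by
  have h := leading_cumulant_mul_le α e (by omega) (re_cumulantPoly_le α e hα hpos)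
  have he' : (3 : ℝ) ≤ e := by exact_mod_cast he
  have he0 : (e : ℝ) ≠ 0 := by positivity
  have hcos : ∀ θ : ℝ, 0 < θ → θ < Real.pi → |Real.cos θ ^ e| < 1 := by
    intro θ h0 h1
    rw [abs_pow]
    refine pow_lt_one₀ (abs_nonneg _) ?_ (by omega)
    have hs := Real.sin_pos_of_pos_of_lt_pi h0 h1
    rw [← sq_lt_one_iff_abs_lt_one]
    nlinarith [Real.sin_sq_add_cos_sq θ]
  rcases lt_trichotomy (α e) 0 with hneg | h0 | hp
  · have h1 := h (Real.pi / e)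
    rw [mul_div_cancel₀ _ he0, Real.cos_pi] at h1
    have h2 := abs_lt.1 (hcos (Real.pi / e) (by positivity) (by
      rw [div_lt_iff₀ (by positivity)]
      nlinarith [Real.pi_pos]))
    nlinarith [h2.1]
  · exact h0
  · have h1 := h (2 * Real.pi / e)
    rw [mul_div_cancel₀ _ he0, Real.cos_two_pi] at h1
    have h2 := abs_lt.1 (hcos (2 * Real.pi / e) (by positivity) (by
      rw [div_lt_iff₀ (by positivity)]
      nlinarith [Real.pi_pos]))
    nlinarith [h2.2]

/-- Marcinkiewicz's theorem: if only finitely many cumulants are nonzero, then all those of order at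
least three vanish. -/
lemma cumulant_eq_zero_of_finite (α : ℕ → ℝ) (e : ℕ) (hα : ∀ k, e < k → α k = 0)
    (hpos : IsMomentLike (momentSeq α)) (k : ℕ) (hk : 3 ≤ k) : α k = 0 := by
  induction e with
  | zero => exact hα k (by omega)
  | succ e ih =>
    rcases Nat.lt_or_ge (e + 1) 3 with he | he
    · exact hα k (by omega)
    · refine ih fun j hj => ?_
      rcases (Nat.succ_le_of_lt hj).eq_or_lt with rfl | hj'
      · exact leading_cumulant_eq_zero α _ he hα hpos
      · exact hα j hj'

/-! ### Janson's criterion: high-order cumulants decide -/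

/-- A scale `≥ 1` that dominates finitely many numbers `|a k| ^ (1 / k)` and, unless it is `1`, is
one of them. -/
lemma exists_dominating_scale (a : ℕ → ℝ) (s : Finset ℕ) (hs : ∀ k ∈ s, 1 ≤ k) :
    ∃ c : ℝ, 1 ≤ c ∧ (∀ k ∈ s, |a k| ≤ c ^ k) ∧ (c = 1 ∨ ∃ k ∈ s, |a k| = c ^ k) := by
  induction s using Finset.induction_on with
  | empty => exact ⟨1, le_rfl, by simp, Or.inl rfl⟩
  | insert k s hk ih =>
    obtain ⟨c, hc1, hc2, hc3⟩ := ih fun j hj => hs j (Finset.mem_insert_of_mem hj)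
    rcases le_or_gt (|a k|) (c ^ k) with h | h
    · refine ⟨c, hc1, fun j hj => ?_, hc3.imp id ?_⟩
      · rcases Finset.mem_insert.1 hj with rfl | hj
        exacts [h, hc2 j hj]
      · rintro ⟨j, hj, hj'⟩
        exact ⟨j, Finset.mem_insert_of_mem hj, hj'⟩
    · have hk1 : k ≠ 0 := by
        have := hs k (Finset.mem_insert_self k s)
        omega
      have hroot : (|a k| ^ ((k : ℝ)⁻¹)) ^ k = |a k| := Real.rpow_inv_natCast_pow (abs_nonneg _) hk1
      have hcc : c ≤ |a k| ^ ((k : ℝ)⁻¹) := by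
        refine le_of_lt (lt_of_pow_lt_pow_left₀ k (by positivity) ?_)
        rwa [hroot]
      refine ⟨|a k| ^ ((k : ℝ)⁻¹), hc1.trans hcc, fun j hj => ?_,
        Or.inr ⟨k, Finset.mem_insert_self k s, hroot.symm⟩⟩
      rcases Finset.mem_insert.1 hj with rfl | hj
      · rw [hroot]
      · exact (hc2 j hj).trans (pow_le_pow_left₀ (by linarith) hcc j)

/-- The cumulants `0, 1, 0, 0, …` of the standard normal law, indexed from `1`. -/
def normalCumulant (k : ℕ) : ℝ := if k = 2 then 1 else 0

/-- Janson's criterion, for the cumulants along an ultrafilter: if the first two cumulants are `0`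
and `1` and all cumulants of large order vanish in the limit, then so do all those of order at
least three. Rescaled so that the cumulants of intermediate order are bounded by one, the moments
converge, and Marcinkiewicz's theorem applies to the limit; it leaves no cumulant of modulus one, so
that in the end no rescaling takes place. -/
lemma tendsto_cumulantSeq_ultrafilter (M : ℕ → ℕ → ℝ) (U : Ultrafilter ℕ)
    (hM0 : ∀ n, M n 0 = 1) (hM : ∀ᶠ n in (U : Filter ℕ), IsMomentLike (M n))
    (h1 : ∀ᶠ n in (U : Filter ℕ), cumulantSeq (M n) 1 = 0)
    (h2 : ∀ᶠ n in (U : Filter ℕ), cumulantSeq (M n) 2 = 1) (k₀ : ℕ)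
    (hk₀ : ∀ k, k₀ ≤ k → Tendsto (fun n => cumulantSeq (M n) k) U (𝓝 0)) (k : ℕ) (hk : 3 ≤ k) :
    Tendsto (fun n => cumulantSeq (M n) k) U (𝓝 0) := by
  have hscale := fun n => exists_dominating_scale (cumulantSeq (M n)) (Finset.Ico 3 k₀)
    fun j hj => by
      have := (Finset.mem_Ico.1 hj).1
      omega
  choose c hc1 hc2 hc3 using hscale
  have hinv0 : ∀ n, 0 ≤ (c n)⁻¹ := fun n => inv_nonneg.2 (zero_le_one.trans (hc1 n))
  have hinv1 : ∀ n, (c n)⁻¹ ≤ 1 := fun n => inv_le_one_of_one_le₀ (hc1 n)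
  set M' : ℕ → ℕ → ℝ := fun n l => (c n)⁻¹ ^ l * M n l with hM'
  have hcum : ∀ n l, cumulantSeq (M' n) l = (c n)⁻¹ ^ l * cumulantSeq (M n) l := fun n l =>
    cumulantSeq_const_pow_mul _ _ _
  have habs : ∀ n l, |cumulantSeq (M' n) l| ≤ |cumulantSeq (M n) l| := fun n l => by
    rw [hcum, abs_mul, abs_of_nonneg (pow_nonneg (hinv0 n) l)]
    exact mul_le_of_le_one_left (abs_nonneg _) (pow_le_one₀ (hinv0 n) (hinv1 n))
  have hlarge : ∀ l, k₀ ≤ l → Tendsto (fun n => cumulantSeq (M' n) l) U (𝓝 0) := fun l hl =>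
    squeeze_zero_norm (fun n => habs n l) (by simpa using (hk₀ l hl).abs)
  have hlim : ∀ l, ∃ α : ℝ, 1 ≤ l → Tendsto (fun n => cumulantSeq (M' n) l) U (𝓝 α) := by
    intro l
    rcases Nat.lt_or_ge l k₀ with hl | hl
    · rcases Nat.eq_zero_or_pos l with rfl | hl0
      · exact ⟨0, fun h => absurd h (by norm_num)⟩
      have hb : ∀ᶠ n in (U : Filter ℕ), cumulantSeq (M' n) l ∈ Set.Icc (-1 : ℝ) 1 := by
        filter_upwards [h1, h2] with n hn1 hn2
        rw [Set.mem_Icc, ← abs_le]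
        rcases Nat.lt_or_ge l 3 with hl3 | hl3
        · refine (habs n l).trans ?_
          interval_cases l
          · simp [hn1]
          · simp [hn2]
        · rw [hcum, abs_mul, abs_of_nonneg (pow_nonneg (hinv0 n) l), inv_pow, inv_mul_le_iff₀
            (pow_pos (zero_lt_one.trans_le (hc1 n)) l), mul_one]
          exact hc2 n l (Finset.mem_Ico.2 ⟨hl3, hl⟩)
      obtain ⟨α, -, hα⟩ := (isCompact_Icc (a := (-1 : ℝ)) (b := 1)).ultrafilter_le_nhds
        (U.map fun n => cumulantSeq (M' n) l) (le_principal_iff.2 hb)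
      exact ⟨α, fun _ => hα⟩
    · exact ⟨0, fun _ => hlarge l hl⟩
  choose α hα using hlim
  have hα0 : ∀ l, k₀ + 1 < l → α l = 0 := fun l hl =>
    tendsto_nhds_unique (hα l (by omega)) (hlarge l (by omega))
  have hmom : ∀ l, Tendsto (fun n => M' n l) U (𝓝 (momentSeq α l)) :=
    tendsto_momentSeq M' (fun n => by simp [hM', hM0]) α hα
  have hlike : IsMomentLike (momentSeq α) :=
    IsMomentLike.of_tendsto (hM.mono fun n hn => hn.pow_mul (c n)⁻¹) hmom
  have hvanish : ∀ l, 3 ≤ l → Tendsto (fun n => cumulantSeq (M' n) l) U (𝓝 0) := fun l hl => by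
    have := hα l (by omega)
    rwa [cumulant_eq_zero_of_finite α _ hα0 hlike l hl] at this
  have hone : ∀ᶠ n in (U : Filter ℕ), c n = 1 := by
    have hsmall : ∀ᶠ n in (U : Filter ℕ), ∀ l ∈ Finset.Ico 3 k₀, |cumulantSeq (M' n) l| < 1 := by
      rw [Finset.eventually_all]
      intro l hl
      have h := (hvanish l (Finset.mem_Ico.1 hl).1).abs
      rw [abs_zero] at h
      exact h.eventually_lt_const zero_lt_one
    filter_upwards [hsmall] with n hn
    refine (hc3 n).resolve_right ?_
    rintro ⟨l, hl, hl'⟩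
    have hcl := pow_pos (zero_lt_one.trans_le (hc1 n)) l
    have := hn l hl
    rw [hcum, abs_mul, abs_of_nonneg (pow_nonneg (hinv0 n) l), hl', inv_pow,
      inv_mul_cancel₀ hcl.ne'] at this
    exact lt_irrefl _ this
  refine (hvanish k hk).congr' ?_
  filter_upwards [hone] with n hn
  rw [hcum, hn]
  simp

/-- Janson's criterion: the moments converge to those of the standard normal law as soon as the
first two cumulants are `0` and `1` and all cumulants of large order vanish in the limit. -/
lemma tendsto_moment_of_tendsto_cumulantSeq (M : ℕ → ℕ → ℝ)
    (hM0 : ∀ n, M n 0 = 1) (hM : ∀ᶠ n in atTop, IsMomentLike (M n))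
    (h1 : ∀ᶠ n in atTop, cumulantSeq (M n) 1 = 0)
    (h2 : ∀ᶠ n in atTop, cumulantSeq (M n) 2 = 1) (k₀ : ℕ)
    (hk₀ : ∀ k, k₀ ≤ k → Tendsto (fun n => cumulantSeq (M n) k) atTop (𝓝 0)) (k : ℕ) :
    Tendsto (fun n => M n k) atTop (𝓝 (momentSeq normalCumulant k)) := by
  refine tendsto_momentSeq M hM0 normalCumulant (fun j hj => ?_) k
  rcases Nat.lt_or_ge j 3 with hj3 | hj3
  · refine Tendsto.congr' ?_ tendsto_const_nhds
    filter_upwards [h1, h2] with n hn1 hn2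
    interval_cases j
    · rw [hn1]
      rfl
    · rw [hn2]
      rfl
  · have : normalCumulant j = 0 := if_neg (by omega)
    rw [this, tendsto_iff_ultrafilter]
    intro U hU
    exact tendsto_cumulantSeq_ultrafilter M U hM0 (hU hM) (hU h1) (hU h2) k₀
      (fun l hl => (hk₀ l hl).mono_left hU) j hj3

/-! ### The moments of the normal law and the method of moments -/

lemma integral_pow_gaussianReal (k : ℕ) :
    ∫ x, x ^ k ∂(gaussianReal 0 1) = momentSeq normalCumulant k := by
  have hmgf : mgf (fun x => x) (gaussianReal 0 1) = fun t => Real.exp (t ^ 2 / 2) := by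
    rw [mgf_fun_id_gaussianReal]
    simp
  have hint : (0 : ℝ) ∈ interior (integrableExpSet (fun x : ℝ => x) (gaussianReal 0 1)) := by
    rw [integrableExpSet_fun_id_gaussianReal, interior_univ]
    exact Set.mem_univ _
  have h := iteratedDeriv_mgf_zero hint k
  have h2 := iteratedDeriv_zero_eq_momentSeq (𝕜 := ℝ) (f := fun t => Real.exp (t ^ 2 / 2))
    (h := fun t => t) (fun n => by fun_prop) (fun n => by fun_prop) (by simp) (by
      ext t
      have hd : HasDerivAt (fun t : ℝ => Real.exp (t ^ 2 / 2))
          (Real.exp (t ^ 2 / 2) * ((2 : ℕ) * t ^ (2 - 1) / 2)) t :=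
        ((hasDerivAt_pow 2 t).div_const 2).exp
      rw [hd.deriv, Pi.mul_apply]
      push_cast
      ring) normalCumulant (fun j => by
      rw [iteratedDeriv_fun_id_zero]
      simp [normalCumulant]) k
  rw [hmgf, h2] at h
  simpa using h.symm

/-- Taylor's formula for the exponential on the imaginary axis, where the remainder is bounded by
the first omitted term. -/
lemma norm_exp_sub_sum_le_of_re_eq_zero (N : ℕ) (z : ℂ) (hz : z.re = 0) :
    ‖Complex.exp z - ∑ j ∈ Finset.range N, z ^ j / j.factorial‖ ≤ ‖z‖ ^ N / N.factorial := by
  induction N generalizing z with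
  | zero =>
    simp [Complex.norm_exp, hz]
  | succ N ih =>
    set f : ℝ → ℂ := fun t =>
      Complex.exp (t * z) - ∑ j ∈ Finset.range (N + 1), (t * z) ^ j / j.factorial with hf
    have hd : ∀ t : ℝ, HasDerivAt f
        (z * (Complex.exp (t * z) - ∑ j ∈ Finset.range N, (t * z) ^ j / j.factorial)) t := by
      intro t
      have h0 : HasDerivAt (fun t : ℝ => (t : ℂ) * z) z t := by
        simpa using (Complex.ofRealCLM.hasDerivAt (x := t)).mul_const z
      have h1 := h0.cexp
      have h2 : HasDerivAt
          (fun t : ℝ => ∑ j ∈ Finset.range (N + 1), ((t : ℂ) * z) ^ j / j.factorial)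
          (∑ j ∈ Finset.range (N + 1), (j * ((t : ℂ) * z) ^ (j - 1) * z) / j.factorial) t :=
        HasDerivAt.fun_sum fun j _ => (h0.pow j).div_const _
      refine (h1.sub h2).congr_deriv ?_
      rw [Finset.sum_range_succ', mul_sub, Finset.mul_sum, mul_comm z]
      simp only [Nat.cast_zero, zero_mul, zero_div, add_zero]
      congr 1
      refine Finset.sum_congr rfl fun j _ => ?_
      have h3 : (j.factorial : ℂ) ≠ 0 := by exact_mod_cast j.factorial_ne_zero
      have h4 : ((j : ℂ) + 1) ≠ 0 := by exact_mod_cast j.succ_ne_zero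
      rw [Nat.factorial_succ, Nat.add_sub_cancel]
      push_cast
      field_simp
    have hB : ∀ t : ℝ, HasDerivAt (fun t : ℝ => t ^ (N + 1) * (‖z‖ ^ (N + 1) / (N + 1).factorial))
        (‖z‖ * (t ^ N * ‖z‖ ^ N / N.factorial)) t := by
      intro t
      refine ((hasDerivAt_pow (N + 1) t).mul_const _).congr_deriv ?_
      have h3 : (N.factorial : ℝ) ≠ 0 := by exact_mod_cast N.factorial_ne_zero
      have h4 : ((N : ℝ) + 1) ≠ 0 := by positivity
      rw [Nat.factorial_succ, Nat.add_sub_cancel]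
      push_cast
      field_simp
      ring
    have key := image_norm_le_of_norm_deriv_right_le_deriv_boundary (a := 0) (b := 1)
      (f := f) (fun t _ => (hd t).continuousAt.continuousWithinAt)
      (fun t _ => (hd t).hasDerivWithinAt) (B := fun t : ℝ =>
        t ^ (N + 1) * (‖z‖ ^ (N + 1) / (N + 1).factorial)) (by simp [hf, Finset.sum_range_succ'])
      hB (fun t ht => by
        rw [norm_mul]
        gcongr
        refine (ih (t * z) (by simp [hz])).trans ?_
        rw [norm_mul, Complex.norm_real, Real.norm_eq_abs, abs_of_nonneg ht.1, mul_pow])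
      (Set.right_mem_Icc.2 zero_le_one)
    simpa [hf] using key

/-- The characteristic function is approximated by its Taylor polynomial of odd degree up to the
next even moment. -/
lemma norm_charFun_sub_sum_le (ν : Measure ℝ) [IsProbabilityMeasure ν]
    (hν : ∀ k : ℕ, Integrable (fun x => x ^ k) ν) (t : ℝ) (K : ℕ) :
    ‖charFun ν t - ∑ j ∈ Finset.range (2 * K),
      (t * Complex.I) ^ j / j.factorial * ((∫ x, x ^ j ∂ν : ℝ) : ℂ)‖
      ≤ t ^ (2 * K) * (∫ x, x ^ (2 * K) ∂ν) / (2 * K).factorial := by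
  have hint : ∀ k : ℕ, Integrable (fun x : ℝ => ((x ^ k : ℝ) : ℂ)) ν := fun k => (hν k).ofReal
  have hexp : Integrable (fun x : ℝ => Complex.exp (t * x * Complex.I)) ν :=
    Integrable.of_bound (by fun_prop) 1 (ae_of_all _ fun x => by
      rw [← Complex.ofReal_mul, Complex.norm_exp_ofReal_mul_I])
  have hsum : ∑ j ∈ Finset.range (2 * K),
      (t * Complex.I) ^ j / j.factorial * ((∫ x, x ^ j ∂ν : ℝ) : ℂ)
      = ∫ x, ∑ j ∈ Finset.range (2 * K),
        (t * Complex.I) ^ j / j.factorial * ((x ^ j : ℝ) : ℂ) ∂ν := by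
    rw [integral_finsetSum _ fun j _ => (hint j).const_mul _]
    refine Finset.sum_congr rfl fun j _ => ?_
    rw [integral_const_mul]
    exact congrArg ((t * Complex.I) ^ j / j.factorial * ·) integral_ofReal.symm
  rw [charFun_apply_real, hsum,
    ← integral_sub hexp (integrable_finsetSum _ fun j _ => (hint j).const_mul _)]
  refine (norm_integral_le_integral_norm _).trans ?_
  rw [← integral_const_mul, ← integral_div]
  refine integral_mono_of_nonneg (ae_of_all _ fun _ => norm_nonneg _)
    (((hν _).const_mul _).div_const _) (ae_of_all _ fun x => ?_)
  have h := norm_exp_sub_sum_le_of_re_eq_zero (2 * K) ((t : ℂ) * x * Complex.I) (by simp)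
  have e : ∑ j ∈ Finset.range (2 * K), ((t : ℂ) * x * Complex.I) ^ j / j.factorial
      = ∑ j ∈ Finset.range (2 * K), (t * Complex.I) ^ j / j.factorial * ((x ^ j : ℝ) : ℂ) := by
    refine Finset.sum_congr rfl fun j _ => ?_
    push_cast
    ring
  rw [e] at h
  refine h.trans (le_of_eq ?_)
  rw [norm_mul, Complex.norm_I, mul_one, norm_mul, Complex.norm_real, Complex.norm_real, mul_pow,
    Real.norm_eq_abs, Real.norm_eq_abs, pow_mul |t|, pow_mul |x|, sq_abs, sq_abs, ← pow_mul,
    ← pow_mul]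

/-- The method of moments: convergence of all moments to those of a law whose exponential moment
series converges implies convergence of the characteristic functions. -/
lemma tendsto_charFun_of_tendsto_moment (ν : ℕ → Measure ℝ) [∀ n, IsProbabilityMeasure (ν n)]
    (γ : Measure ℝ) [IsProbabilityMeasure γ]
    (hν : ∀ n (k : ℕ), Integrable (fun x => x ^ k) (ν n))
    (hγ : ∀ k : ℕ, Integrable (fun x => x ^ k) γ)
    (hlim : ∀ k : ℕ, Tendsto (fun n => ∫ x, x ^ k ∂(ν n)) atTop (𝓝 (∫ x, x ^ k ∂γ)))
    (hser : ∀ t : ℝ, Tendsto (fun k : ℕ => t ^ k * (∫ x, x ^ k ∂γ) / k.factorial) atTop (𝓝 0))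
    (t : ℝ) : Tendsto (fun n => charFun (ν n) t) atTop (𝓝 (charFun γ t)) := by
  rw [tendsto_iff_norm_sub_tendsto_zero, Metric.tendsto_nhds]
  intro ε hε
  have hsub : Tendsto (fun K : ℕ => 2 * K) atTop atTop :=
    tendsto_id.const_mul_atTop' (by norm_num)
  obtain ⟨K, hK⟩ := (((hser t).comp hsub).eventually_lt_const
    (show (0 : ℝ) < ε / 4 by positivity)).exists
  simp only [Function.comp_apply] at hK
  set T : Measure ℝ → ℂ := fun ρ => ∑ j ∈ Finset.range (2 * K),
      (t * Complex.I) ^ j / j.factorial * ((∫ x, x ^ j ∂ρ : ℝ) : ℂ) with hT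
  have h1 : ∀ᶠ n in atTop, t ^ (2 * K) * (∫ x, x ^ (2 * K) ∂(ν n)) / (2 * K).factorial < ε / 4 :=
    (((hlim (2 * K)).const_mul _).div_const _).eventually_lt_const hK
  have h2 : Tendsto (fun n => T (ν n)) atTop (𝓝 (T γ)) :=
    tendsto_finsetSum _ fun j _ => ((Complex.continuous_ofReal.tendsto _).comp (hlim j)).const_mul _
  have h3 := (tendsto_iff_norm_sub_tendsto_zero.1 h2).eventually_lt_const
    (show (0 : ℝ) < ε / 4 by positivity)
  filter_upwards [h1, h3] with n hn1 hn3
  rw [Real.dist_eq, sub_zero, abs_norm]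
  have b1 := norm_charFun_sub_sum_le (ν n) (hν n) t K
  have b2 := norm_charFun_sub_sum_le γ hγ t K
  have e : charFun (ν n) t - charFun γ t
      = (charFun (ν n) t - T (ν n)) + (T (ν n) - T γ) - (charFun γ t - T γ) := by ring
  rw [e]
  have b3 := norm_sub_le ((charFun (ν n) t - T (ν n)) + (T (ν n) - T γ)) (charFun γ t - T γ)
  have b4 := norm_add_le (charFun (ν n) t - T (ν n)) (T (ν n) - T γ)
  linarith

/-- The method of moments for the standard normal law, in terms of distribution functions. -/
lemma tendsto_cdf_of_tendsto_moment {Ω : ℕ → Type*} [∀ n, MeasurableSpace (Ω n)]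
    (P : ∀ n, Measure (Ω n)) [∀ n, IsProbabilityMeasure (P n)] (Y : ∀ n, Ω n → ℝ)
    (hY : ∀ n, Measurable (Y n)) (hYb : ∀ n, ∃ C : ℝ, ∀ ω, |Y n ω| ≤ C)
    (hlim : ∀ k : ℕ, Tendsto (fun n => ∫ ω, Y n ω ^ k ∂(P n)) atTop
      (𝓝 (∫ x, x ^ k ∂(gaussianReal 0 1)))) (x : ℝ) :
    Tendsto (fun n => (P n).real {ω | Y n ω ≤ x}) atTop (𝓝 (cdf (gaussianReal 0 1) x)) := by
  have hprob : ∀ n, IsProbabilityMeasure ((P n).map (Y n)) := fun n =>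
    Measure.isProbabilityMeasure_map (hY n).aemeasurable
  have hmap : ∀ n (k : ℕ), ∫ x, x ^ k ∂((P n).map (Y n)) = ∫ ω, Y n ω ^ k ∂(P n) := fun n k =>
    integral_map (hY n).aemeasurable (by fun_prop)
  have hν : ∀ n (k : ℕ), Integrable (fun x => x ^ k) ((P n).map (Y n)) := fun n k => by
    rw [integrable_map_measure (by fun_prop) (hY n).aemeasurable]
    obtain ⟨C, hC⟩ := hYb n
    refine Integrable.of_bound ((hY n).pow_const k).aestronglyMeasurable (C ^ k)
      (ae_of_all _ fun ω => ?_)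
    rw [Function.comp_apply, norm_pow]
    exact pow_le_pow_left₀ (norm_nonneg _) (hC ω) k
  have hγ : ∀ k : ℕ, Integrable (fun x : ℝ => x ^ k) (gaussianReal 0 1) := fun k => by
    have h := (memLp_id_gaussianReal (μ := 0) (v := 1) k).integrable_norm_pow'
    refine (integrable_norm_iff (by fun_prop)).1 (h.congr (ae_of_all _ fun x => ?_))
    simp
  have hser : ∀ t : ℝ, Tendsto
      (fun k : ℕ => t ^ k * (∫ x, x ^ k ∂(gaussianReal 0 1)) / k.factorial) atTop (𝓝 0) := by
    intro t
    have h := (hasSum_momentSeq normalCumulant 2 (fun k hk => if_neg (by omega))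
      (t : ℂ)).summable.tendsto_atTop_zero
    have h' := (Complex.continuous_re.tendsto _).comp h
    rw [Complex.zero_re] at h'
    refine h'.congr fun k => ?_
    rw [Function.comp_apply, integral_pow_gaussianReal]
    have : (momentSeq normalCumulant k : ℂ) * ((t : ℂ) ^ k / k.factorial)
        = ((t ^ k * momentSeq normalCumulant k / k.factorial : ℝ) : ℂ) := by
      push_cast
      ring
    rw [this, Complex.ofReal_re]
  have hchar := tendsto_charFun_of_tendsto_moment (fun n => (P n).map (Y n)) (gaussianReal 0 1)
    hν hγ (fun k => by simpa only [hmap] using hlim k) hser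
  set Q : ℕ → ProbabilityMeasure ℝ := fun n => ⟨(P n).map (Y n), hprob n⟩ with hQ
  set N : ProbabilityMeasure ℝ := ⟨gaussianReal 0 1, inferInstance⟩ with hN
  have hweak : Tendsto Q atTop (𝓝 N) := ProbabilityMeasure.tendsto_iff_tendsto_charFun.2 hchar
  have hnull : (N : Measure ℝ) (frontier (Set.Iic x)) = 0 := by
    have := nullSingletonClass_gaussianReal (μ := 0) (v := 1) one_ne_zero
    rw [frontier_Iic]
    exact measure_singleton (μ := gaussianReal 0 1) x
  have hport := ProbabilityMeasure.tendsto_measure_of_null_frontier_of_tendsto' hweak hnull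
  have hreal := (ENNReal.tendsto_toReal
    (measure_ne_top (gaussianReal 0 1) (Set.Iic x))).comp hport
  rw [cdf_eq_real]
  refine hreal.congr fun n => ?_
  have h : (P n).map (Y n) (Set.Iic x) = P n {ω | Y n ω ≤ x} :=
    Measure.map_apply (hY n) measurableSet_Iic
  exact congrArg ENNReal.toReal h

/-! ### Asymptotic normality of the `V`-statistic -/

section Standardized

variable {Ω : Type*} [MeasurableSpace Ω] (μ : Measure Ω) {Y : Ω → ℝ}

lemma measurable_standardized (hY : Measurable Y) : Measurable (standardized μ Y) :=
  (hY.sub_const _).div_const _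

lemma exists_abs_standardized_le {C : ℝ} (hC : ∀ ω, |Y ω| ≤ C) :
    ∃ C' : ℝ, ∀ ω, |standardized μ Y ω| ≤ C' := by
  refine ⟨(C + |∫ ω, Y ω ∂μ|) / √(variance Y μ), fun ω => ?_⟩
  rw [standardized, abs_div, abs_of_nonneg (Real.sqrt_nonneg _)]
  gcongr
  exact (abs_sub _ _).trans (by gcongr; exact hC ω)

lemma integral_standardized [IsProbabilityMeasure μ] (hY : Integrable Y μ) :
    ∫ ω, standardized μ Y ω ∂μ = 0 := by
  unfold standardized
  rw [integral_div, integral_sub hY (integrable_const _)]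
  simp

lemma integral_standardized_sq (hY : Measurable Y) (hv : 0 < variance Y μ) :
    ∫ ω, standardized μ Y ω ^ 2 ∂μ = 1 := by
  unfold standardized
  simp_rw [div_pow, Real.sq_sqrt hv.le]
  rw [integral_div, ← variance_eq_integral hY.aemeasurable, div_self hv.ne']

lemma cumulantSeq_standardized_one [IsProbabilityMeasure μ] (hY : Integrable Y μ) :
    cumulantSeq (fun l => ∫ ω, standardized μ Y ω ^ l ∂μ) 1 = 0 := by
  rw [cumulantSeq_one]
  simpa using integral_standardized μ hY

lemma cumulantSeq_standardized_two [IsProbabilityMeasure μ] (hY : Measurable Y)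
    (hi : Integrable Y μ) (hv : 0 < variance Y μ) :
    cumulantSeq (fun l => ∫ ω, standardized μ Y ω ^ l ∂μ) 2 = 1 := by
  rw [cumulantSeq_two, cumulantSeq_standardized_one μ hi, zero_mul, sub_zero,
    integral_standardized_sq μ hY hv]

end Standardized

theorem mainTheorem2
    {Ω : ℕ → Type*} [∀ n, MeasurableSpace (Ω n)]
    (P : ∀ n, Measure (Ω n)) [∀ n, IsProbabilityMeasure (P n)]
    (X : ∀ n, ℕ → Ω n → ℝ)
    (hX_meas : ∀ n t, Measurable (X n t))
    (hX_stat : ∀ n, StrictlyStationary (P n) (X n))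
    (hX_reg : ∀ n, AbsolutelyRegular (P n) (X n))
    (r : ℕ)
    (f : ∀ n, (Fin r → Fin n) → (Fin r → ℝ) → ℝ)
    (hf_meas : ∀ n j, Measurable (f n j))
    (F : ℕ → ℝ)
    (hF : ∀ n j x, |f n j x| ≤ F n)
    (m : ℕ → ℕ)
    (hm : ∀ n, 1 ≤ m n)
    (hvar : ∀ᶠ n in atTop, 0 < variance (vStat (f n) (X n)) (P n))
    (hcond : ∃ b₀ ∈ Set.Ioc (0 : ℝ) (2 / 3), ∀ b ∈ Set.Ioc (0 : ℝ) b₀,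
      Tendsto (fun n : ℕ =>
        F n ^ 2 * (m n : ℝ) ^ (2 - b) * (n : ℝ) ^ (2 * ((r : ℝ) - 1) + b) * (r : ℝ) ^ (4 - 2 * b)
            / variance (vStat (f n) (X n)) (P n)
          + absRegCoeff (P n) (X n) (m n) ^ b
            * (F n ^ 2 * (n : ℝ) ^ (2 * r) / variance (vStat (f n) (X n)) (P n)))
        atTop (𝓝 0)) :
    (∀ k : ℕ, Tendsto
      (fun n => ∫ ω, standardized (P n) (vStat (f n) (X n)) ω ^ k ∂(P n))
      atTop (𝓝 (∫ x, x ^ k ∂(gaussianReal 0 1)))) ∧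
    (∀ x : ℝ, Tendsto
      (fun n => (P n).real {ω | standardized (P n) (vStat (f n) (X n)) ω ≤ x})
      atTop (𝓝 (cdf (gaussianReal 0 1) x))) := by
  have hVm : ∀ n, Measurable (vStat (f n) (X n)) := fun n =>
    measurable_vStat (hX_meas n) (hf_meas n)
  have hVb : ∀ n ω, |vStat (f n) (X n) ω| ≤ Fintype.card (Fin r → Fin n) * F n := fun n =>
    abs_vStat_le (hF n)
  have hVi : ∀ n, Integrable (vStat (f n) (X n)) (P n) := fun n =>
    Integrable.of_bound (hVm n).aestronglyMeasurable _ (ae_of_all _ (hVb n))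
  -- A statistic that does not vary has variance zero; this excludes `r = 0` and `F n ≤ 0`.
  have hconst : ∀ n (c : ℝ), (∀ ω, vStat (f n) (X n) ω = c) →
      ¬ 0 < variance (vStat (f n) (X n)) (P n) := fun n c hc hv => by
    have : vStat (f n) (X n) = fun _ => c := funext hc
    rw [this, variance_eq_integral measurable_const.aemeasurable] at hv
    simp at hv
  have hr : 1 ≤ r := by
    by_contra h
    obtain rfl : r = 0 := by omega
    obtain ⟨n, hn⟩ := hvar.exists
    refine hconst n (∑ j, f n j 0) (fun ω => ?_) hn
    exact Finset.sum_congr rfl fun j _ => congrArg (f n j) (Subsingleton.elim _ _)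
  have hF0 : ∀ᶠ n in atTop, 0 < F n := by
    filter_upwards [hvar] with n hn
    by_contra h
    refine hconst n 0 (fun ω => Finset.sum_eq_zero fun j _ => ?_) hn
    exact abs_nonpos_iff.1 ((hF n j _).trans (not_lt.1 h))
  obtain ⟨b₀, ⟨hb0, -⟩, hcond⟩ := hcond
  set M : ℕ → ℕ → ℝ := fun n k => ∫ ω, standardized (P n) (vStat (f n) (X n)) ω ^ k ∂(P n) with hM
  have hmom : ∀ k, Tendsto (fun n => M n k) atTop (𝓝 (∫ x, x ^ k ∂(gaussianReal 0 1))) := by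
    intro k
    rw [integral_pow_gaussianReal]
    refine tendsto_moment_of_tendsto_cumulantSeq M (fun n => by simp [hM])
      (Eventually.of_forall fun n => ?_)
      (Eventually.of_forall fun n => cumulantSeq_standardized_one (P n) (hVi n))
      (hvar.mono fun n hn => cumulantSeq_standardized_two (P n) (hVm n) (hVi n) hn)
      (⌈2 / b₀⌉₊ + 1) (fun l hl => ?_) k
    · obtain ⟨C, hC⟩ := exists_abs_standardized_le (P n) (hVb n)
      exact isMomentLike_integral (P n) (measurable_standardized (P n) (hVm n)) hC
    · have hl0 : (0 : ℝ) < l := by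
        have : 0 < l := by omega
        exact_mod_cast this
      have hlb : 2 / b₀ ≤ l := (Nat.le_ceil _).trans (by exact_mod_cast (by omega))
      exact tendsto_cumulantSeq_standardized P X hX_meas r hr f hf_meas F hF m hm hvar hF0 l
        (by omega) (hcond (2 / l) ⟨by positivity, (div_le_comm₀ hb0 hl0).1 hlb⟩)
  refine ⟨hmom, tendsto_cdf_of_tendsto_moment P _ (fun n => measurable_standardized (P n) (hVm n))
    (fun n => exists_abs_standardized_le (P n) (hVb n)) hmom⟩
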